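/- Fix $0<p<1$, a positive integer $L$ and $\gamma,\mu_1,\dots,\mu_L\in\mathbb{C}$, and write $$[x]=\frac12\sum_{n\in\mathbb{Z}}(-1)^{n-\frac12}\,p^{(n+\frac12)^2}e^{-(2n+1)x},\qquad (-1)^{n-\frac12}:=e^{i\pi(n-\frac12)} .$$ On $\mathbb{C}^2\otimes\mathbb{C}^2$, in the ordered basis $v_1\otimes v_1,\,v_1\otimes v_2,\,v_2\otimes v_1,\,v_2\otimes v_2$, let $$\mathcal{R}(x;\tau)=\begin{pmatrix}[x+\gamma]&0&0&0\\0&\frac{[\tau-\gamma][x]}{[\tau]}&\frac{[\tau-x][\gamma]}{[\tau]}&0\\0&\frac{[\tau+x][\gamma]}{[\tau]}&\frac{[\tau+\gamma][x]}{[\tau]}&0\\0&0&0&[x+\gamma]\end{pmatrix}.$$ On $\mathbb{C}^2_{(0)}\otimes(\mathbb{C}^2)^{\otimes L}$ define the dynamical monodromy matrix $$\mathcal{T}_0(x,\tau)=\mathcal{R}_{01}\Big(x-\mu_1;\tau-\gamma\sum_{k=2}^{L}h_k\Big)\,\mathcal{R}_{02}\Big(x-\mu_2;\tau-\gamma\sum_{k=3}^{L}h_k\Big)\cdots\mathcal{R}_{0L}(x-\mu_L;\tau),$$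 where $h_k$ acts on the $k$-th factor with $hv_1=v_1$, $hv_2=-v_2$, and let $\mathcal{B}(x,\tau)$ be the upper right entry of $\mathcal{T}_0(x,\tau)$ written as a $2\times2$ matrix over the $0$-th factor. The elliptic SOS domain-wall partition function is $$Z_\tau(x_1,\dots,x_L)=\langle\bar 0|\,\mathcal{B}(x_1,\tau+\gamma)\,\mathcal{B}(x_2,\tau+2\gamma)\cdots\mathcal{B}(x_L,\tau+L\gamma)\,|0\rangle,$$ where $|0\rangle=\binom{1}{0}^{\otimes L}$ and $\langle\bar 0|=(0\;\;1)^{\otimes L}$. Theorem (Equation type A). Let $\tau,x_0,x_1,\dots,x_L\in\mathbb{C}$ be such that $[\tau+n\gamma]\neq0$ for $1\le n\le L+2$ and $[x_j-x_i]\ne0$ for all $0\le i\neq j\le L$. Put $X=(x_1,\dots,x_L)$, $X_0^0=X$, and for $1\le i\le L$ let $X_i^0$ be $X$ with $x_i$ replaced by $x_0$. Then $$M_0\,Z_\tau(X)+\sum_{i=0}^{L}N_i\,Z_{\tau+\gamma}(X_i^0)=0,$$ where $$M_0=\frac{[\tau+\gamma]}{[\tau+(L+1)\gamma]}\prod_{j=1}^L[x_0-\mu_j],$$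 $$N_0=-\frac{[\tau+2\gamma]}{[\tau+(L+2)\gamma]}\prod_{j=1}^L[x_0-\mu_j+\gamma]\prod_{j=1}^L\frac{[x_j-x_0+\gamma]}{[x_j-x_0]},$$ $$N_i=\frac{[\tau+2\gamma+x_0-x_i]\,[\gamma]}{[x_i-x_0]\,[\tau+(L+2)\gamma]}\prod_{j=1}^L[x_i-\mu_j+\gamma]\prod_{\substack{j=1\\ j\ne i}}^L\frac{[x_j-x_i+\gamma]}{[x_j-x_i]}\qquad(1\le i\le L).$$ -/

import Mathlib

noncomputable section

namespace EllipticSOS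

/-- The theta function `[x]` with elliptic nome `p`:
`[x] = (1/2) ∑_{n ∈ ℤ} (-1)^(n - 1/2) p^((n + 1/2)^2) e^(-(2n+1)x)`, with `(-1)^(n-1/2)` taken on
the principal branch, i.e. equal to `e^(iπ(n-1/2))`. -/
def theta (p : ℝ) (x : ℂ) : ℂ :=
  (1 / 2) * ∑' n : ℤ, (-1 : ℂ) ^ ((n : ℂ) - 1 / 2) *
    ((p ^ (((n : ℝ) + 1 / 2) ^ 2) : ℝ) : ℂ) * Complex.exp (-(2 * (n : ℂ) + 1) * x)

/-- The series defining `[x]` converges absolutely for `0 < p < 1`. -/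
theorem summable_theta (p : ℝ) (hp0 : 0 < p) (hp1 : p < 1) (x : ℂ) :
    Summable fun n : ℤ => (-1 : ℂ) ^ ((n : ℂ) - 1 / 2) *
      ((p ^ (((n : ℝ) + 1 / 2) ^ 2) : ℝ) : ℂ) * Complex.exp (-(2 * (n : ℂ) + 1) * x) := by
  have hpi : (Real.pi : ℂ) ≠ 0 := by exact_mod_cast Real.pi_ne_zero
  set l : ℝ := Real.log p with hl
  have hlneg : l < 0 := Real.log_neg hp0 hp1
  set t : ℂ := ((-l / Real.pi : ℝ) : ℂ) * Complex.I with ht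
  set z : ℂ := ((l : ℂ) + Real.pi * Complex.I - 2 * x) / (2 * Real.pi * Complex.I) with hz
  have him : 0 < t.im := by
    simp only [ht, Complex.mul_im, Complex.ofReal_re, Complex.I_im, Complex.ofReal_im,
      Complex.I_re]
    have := div_pos (neg_pos.mpr hlneg) Real.pi_pos
    linarith
  have hs := (hasSum_jacobiTheta₂_term z him).summable.mul_left
    (Complex.exp ((l : ℂ) / 4 - Real.pi * Complex.I / 2 - x))
  refine hs.congr fun n => ?_
  rw [jacobiTheta₂_term, Complex.cpow_def_of_ne_zero (by norm_num), Complex.log_neg_one,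
    Real.rpow_def_of_pos hp0, ← hl, Complex.ofReal_exp, ← Complex.exp_add, ← Complex.exp_add,
    ← Complex.exp_add]
  congr 1
  have hI := Complex.I_mul_I
  have h1 : 2 * (Real.pi : ℂ) * Complex.I * n * z
      = n * ((l : ℂ) + Real.pi * Complex.I - 2 * x) := by
    rw [hz]; field_simp
  have h2 : (Real.pi : ℂ) * Complex.I * n ^ 2 * t = (n : ℂ) ^ 2 * l := by
    rw [ht]; push_cast; field_simp
    linear_combination (-((n : ℂ) ^ 2 * l)) * hI
  rw [h1, h2]; push_cast; ring

/-- The dynamical `R`-matrix on `ℂ² ⊗ ℂ²`, in the ordered basis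
`v₁⊗v₁, v₁⊗v₂, v₂⊗v₁, v₂⊗v₂` (`v₁, v₂` are indexed by `0, 1 : Fin 2`, and
`finProdFinEquiv (a, b) = 2 a + b`). -/
def rMatrix (p : ℝ) (γ x τ : ℂ) : Matrix (Fin 2 × Fin 2) (Fin 2 × Fin 2) ℂ :=
  (!![theta p (x + γ), 0, 0, 0;
      0, theta p (τ - γ) * theta p x * (theta p τ)⁻¹,
        theta p (τ - x) * theta p γ * (theta p τ)⁻¹, 0;
      0, theta p (τ + x) * theta p γ * (theta p τ)⁻¹,
        theta p (τ + γ) * theta p x * (theta p τ)⁻¹, 0;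
      0, 0, 0, theta p (x + γ)]).submatrix finProdFinEquiv finProdFinEquiv

/-- The eigenvalues of the Cartan element on `v₁` and `v₂`. -/
def cartanWeight : Fin 2 → ℂ := ![1, -1]

/-- The operator `R_{0i}(x; τ - γ ∑_{k > i} h_k)` on `W₀ ⊗ W^{⊗L}`, as a matrix in the standard
basis: a basis vector is a pair of an auxiliary index in `Fin 2` and a tuple `Fin L → Fin 2`, and
`h_k` acts by the weight of the `k`-th tensor factor. -/
def dynR (p : ℝ) (γ : ℂ) {L : ℕ} (i : Fin L) (x τ : ℂ) :
    Matrix (Fin 2 × (Fin L → Fin 2)) (Fin 2 × (Fin L → Fin 2)) ℂ :=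
  Matrix.of fun u v =>
    if ∀ k, k ≠ i → u.2 k = v.2 k then
      rMatrix p γ x (τ - γ * ∑ k ∈ Finset.Ioi i, cartanWeight (v.2 k)) (u.1, u.2 i) (v.1, v.2 i)
    else 0

/-- The dynamical monodromy matrix: the product of the
`R_{0i}(x - μ_i; τ - γ ∑_{k > i} h_k)`, with `i` increasing from left to right. -/
def monodromy (p : ℝ) (γ : ℂ) {L : ℕ} (μ : Fin L → ℂ) (x τ : ℂ) :
    Matrix (Fin 2 × (Fin L → Fin 2)) (Fin 2 × (Fin L → Fin 2)) ℂ :=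
  (List.ofFn fun i : Fin L => dynR p γ i (x - μ i) τ).prod

/-- The operator `B(x, τ)` on `W^{⊗L}`: the upper right block of the monodromy matrix
`!![A, B; C, D]` with respect to the auxiliary space. -/
def opB (p : ℝ) (γ : ℂ) {L : ℕ} (μ : Fin L → ℂ) (x τ : ℂ) :
    Matrix (Fin L → Fin 2) (Fin L → Fin 2) ℂ :=
  Matrix.of fun s t => monodromy p γ μ x τ (0, s) (1, t)

/-- The highest-weight vector `(1, 0)^{⊗L}`. -/
def ketZero (L : ℕ) : (Fin L → Fin 2) → ℂ := fun s => ∏ i, (![1, 0] : Fin 2 → ℂ) (s i)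

/-- The dual highest-weight vector `(0, 1)^{⊗L}`. -/
def braZeroBar (L : ℕ) : (Fin L → Fin 2) → ℂ := fun s => ∏ i, (![0, 1] : Fin 2 → ℂ) (s i)

/-- The domain-wall partition function
`Z_τ(x_1, …, x_L) = ⟨0̄| B(x_1, τ + γ) B(x_2, τ + 2γ) ⋯ B(x_L, τ + Lγ) |0⟩`
(the index `j : Fin L` runs over `0, …, L - 1`, hence the shift `j + 1`). -/
def partitionFunction (p : ℝ) (γ : ℂ) {L : ℕ} (μ : Fin L → ℂ) (τ : ℂ) (x : Fin L → ℂ) : ℂ :=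
  dotProduct (braZeroBar L)
    ((List.ofFn fun j : Fin L => opB p γ μ (x j) (τ + ((j : ℕ) + 1 : ℂ) * γ)).prod.mulVec
      (ketZero L))

/-- The coefficient `M_0`. -/
def coeffM (p : ℝ) (γ : ℂ) {L : ℕ} (μ : Fin L → ℂ) (τ x₀ : ℂ) : ℂ :=
  theta p (τ + γ) / theta p (τ + ((L : ℂ) + 1) * γ) * ∏ j, theta p (x₀ - μ j)

/-- The coefficient `N_0`. -/
def coeffNZero (p : ℝ) (γ : ℂ) {L : ℕ} (μ : Fin L → ℂ) (τ x₀ : ℂ) (x : Fin L → ℂ) : ℂ :=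
  -(theta p (τ + 2 * γ) / theta p (τ + ((L : ℂ) + 2) * γ)) * (∏ j, theta p (x₀ - μ j + γ)) *
    ∏ j, theta p (x j - x₀ + γ) / theta p (x j - x₀)

/-- The coefficient `N_i`, `i = 1, …, L`. -/
def coeffN (p : ℝ) (γ : ℂ) {L : ℕ} (μ : Fin L → ℂ) (τ x₀ : ℂ) (x : Fin L → ℂ) (i : Fin L) : ℂ :=
  theta p (τ + 2 * γ + x₀ - x i) * theta p γ /
      (theta p (x i - x₀) * theta p (τ + ((L : ℂ) + 2) * γ)) *
    (∏ j, theta p (x i - μ j + γ)) *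
    ∏ j ∈ Finset.univ.erase i, theta p (x j - x i + γ) / theta p (x j - x i)

end EllipticSOS

end

/-! ### Theta functions: addition formula and three-term identity. -/

namespace EllipticSOS

open Complex

/-! The equation comes from computing ⟨0̄| A(x₀, τ+2γ) B(x₁, τ+γ) ⋯ B(x_L, τ+Lγ) |0⟩ in two ways,
where A is the upper left entry of the monodromy matrix. The covector ⟨0̄| is a left eigenvector of
A, with an eigenvalue that is exactly M₀, so acting to the left gives M₀ Z_τ(X)
(`braZeroBar_vecMul_entryA`). Moving A to the right through the B's raises every height by γ and
ends on |0⟩, a right eigenvector (`entryA_mulVec_ketZero`). This gives Z_{τ+γ} at X, or at X with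
one x_i exchanged for x₀, with coefficients -N₀ and -N_i (`entryA_mulVec_prodB`).

The exchange rules for A with B and for B with B are components of the dynamical RTT relation
`monodromy_exchange`. It follows site by site from the dynamical Yang-Baxter equation `yangBaxter`,
whose components reduce to the three-term theta identity `theta_three_term`.

This argument divides by theta values at heights outside the assumed range, so it is run only for σ
with [σ + nγ] ≠ 0 for all integers n. Such σ are dense by Baire's theorem. Both sides are continuous
at τ under the finite list of hypotheses, because a spin count shows that only the heights τ+γ, …,
τ+(L+1)γ occur in denominators of Z_τ (`continuousAt_partitionFunction`). -/

theorem neg_one_cpow_int_sub_half (n : ℤ) :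
    (-1 : ℂ) ^ ((n : ℂ) - 1 / 2) = -I * (-1 : ℂ) ^ n := by
  rw [cpow_sub _ _ (by norm_num), cpow_intCast]
  have : (-1 : ℂ) ^ (1 / 2 : ℂ) = I := by
    rw [cpow_def_of_ne_zero (by norm_num), log_neg_one,
      show (Real.pi : ℂ) * I * (1 / 2) = Real.pi / 2 * I by ring, exp_pi_div_two_mul_I]
  rw [this, div_I]; ring

/-- The reflection n ↦ -1 - n preserves (n + 1/2)² and reverses the sign (-1)ⁿ. -/
theorem theta_neg (p : ℝ) (x : ℂ) : theta p (-x) = -theta p x := by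
  unfold theta
  rw [← mul_neg, ← tsum_neg]
  congr 1
  rw [← (Equiv.subLeft (-1 : ℤ)).tsum_eq]
  refine tsum_congr fun n => ?_
  simp only [Equiv.subLeft_apply, neg_one_cpow_int_sub_half]
  have h1 : (((-1 - n : ℤ) : ℝ) + 1 / 2) ^ 2 = ((n : ℝ) + 1 / 2) ^ 2 := by push_cast; ring
  have h2 : -(2 * ((-1 - n : ℤ) : ℂ) + 1) * -x = -(2 * (n : ℂ) + 1) * x := by push_cast; ring
  have h3 : (-1 : ℂ) ^ (-1 - n) = -(-1 : ℂ) ^ n := by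
    rw [zpow_sub₀ (by norm_num), zpow_neg_one]
    rcases Int.even_or_odd n with h | h <;> simp [h.neg_one_zpow]
  rw [h1, h2, h3]; ring

/-- The summand of the theta functions of nome `√p` over `ℤ`, whose even and odd parts appear in
the addition formula. -/
noncomputable def gaussTerm (p : ℝ) (k : ℤ) (x : ℂ) : ℂ :=
  ((p ^ ((k : ℝ) ^ 2 / 2) : ℝ) : ℂ) * Complex.exp (-(2 * (k : ℂ)) * x)

noncomputable def thetaEven (p : ℝ) (x : ℂ) : ℂ := ∑' i : ℤ, gaussTerm p (2 * i) x

noncomputable def thetaOdd (p : ℝ) (x : ℂ) : ℂ := ∑' i : ℤ, gaussTerm p (2 * i + 1) x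

/-- Since (n+1/2)² + (m+1/2)² = ((n+m+1)² + (n-m)²)/2, a product of terms at x + y and x - y
separates into a factor in x and a factor in y. The new indices n+m+1 and n-m have opposite parity,
and the two cases give the two products in the addition formula. -/
theorem theta_term_mul (p : ℝ) (hp0 : 0 < p) (x y : ℂ) (n m : ℤ) :
    ((-1 : ℂ) ^ ((n : ℂ) - 1 / 2) * ((p ^ (((n : ℝ) + 1 / 2) ^ 2) : ℝ) : ℂ) *
        Complex.exp (-(2 * (n : ℂ) + 1) * (x + y))) *
      ((-1 : ℂ) ^ ((m : ℂ) - 1 / 2) * ((p ^ (((m : ℝ) + 1 / 2) ^ 2) : ℝ) : ℂ) *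
        Complex.exp (-(2 * (m : ℂ) + 1) * (x - y)))
    = (-1 : ℂ) ^ (n + m + 1) * gaussTerm p (n + m + 1) x * gaussTerm p (n - m) y := by
  rw [neg_one_cpow_int_sub_half, neg_one_cpow_int_sub_half, gaussTerm, gaussTerm]
  have h1 : p ^ (((n : ℝ) + 1 / 2) ^ 2) * p ^ (((m : ℝ) + 1 / 2) ^ 2)
      = p ^ (((n + m + 1 : ℤ) : ℝ) ^ 2 / 2) * p ^ (((n - m : ℤ) : ℝ) ^ 2 / 2) := by
    rw [← Real.rpow_add hp0, ← Real.rpow_add hp0]; congr 1; push_cast; ring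
  have h1' := congrArg (fun r : ℝ => (r : ℂ)) h1
  simp only [ofReal_mul] at h1'
  have h2 : Complex.exp (-(2 * (n : ℂ) + 1) * (x + y)) * Complex.exp (-(2 * (m : ℂ) + 1) * (x - y))
      = Complex.exp (-(2 * ((n + m + 1 : ℤ) : ℂ)) * x) *
        Complex.exp (-(2 * ((n - m : ℤ) : ℂ)) * y) := by
    rw [← Complex.exp_add, ← Complex.exp_add]; congr 1; push_cast; ring
  have h3 : (-1 : ℂ) ^ (n + m + 1) = -((-1 : ℂ) ^ n * (-1 : ℂ) ^ m) := by
    rw [zpow_add₀ (by norm_num), zpow_add₀ (by norm_num)]; simp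
  rw [h3]
  calc _ = (I * I * ((-1 : ℂ) ^ n * (-1 : ℂ) ^ m)) *
        (((p ^ (((n : ℝ) + 1 / 2) ^ 2) : ℝ) : ℂ) * ((p ^ (((m : ℝ) + 1 / 2) ^ 2) : ℝ) : ℂ)) *
        (Complex.exp (-(2 * (n : ℂ) + 1) * (x + y)) *
          Complex.exp (-(2 * (m : ℂ) + 1) * (x - y))) := by ring
    _ = _ := by rw [h1', h2, I_mul_I]; ring

/-- Pairs of integers, split according to the parity of their difference. -/
def parityEquiv : (ℤ × ℤ) ⊕ (ℤ × ℤ) ≃ ℤ × ℤ where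
  toFun := Sum.elim (fun q => (q.1 + q.2, q.1 - q.2 - 1)) (fun q => (q.1 + q.2, q.1 - q.2))
  invFun q := if Even (q.1 - q.2) then Sum.inr ((q.1 + q.2) / 2, (q.1 - q.2) / 2)
    else Sum.inl ((q.1 + q.2 + 1) / 2, (q.1 - q.2 - 1) / 2)
  left_inv := by
    rintro (⟨i, j⟩ | ⟨i, j⟩)
    · have h : ¬ Even (i + j - (i - j - 1)) := by
        rw [Int.not_even_iff_odd]; exact ⟨j, by ring⟩
      simp only [Sum.elim_inl, h, if_false, Sum.inl.injEq, Prod.mk.injEq]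
      constructor <;> omega
    · have h : Even (i + j - (i - j)) := ⟨j, by ring⟩
      simp only [Sum.elim_inr, h, if_true, Sum.inr.injEq, Prod.mk.injEq]
      constructor <;> omega
  right_inv := by
    rintro ⟨n, m⟩
    by_cases h : Even (n - m)
    · obtain ⟨k, hk⟩ := id h
      simp only [h, if_true, Sum.elim_inr, Prod.mk.injEq]
      constructor <;> omega
    · obtain ⟨k, hk⟩ := Int.not_even_iff_odd.mp h
      simp only [h, if_false, Sum.elim_inl, Prod.mk.injEq]
      constructor <;> omega

/-- The right side is a 2×2 determinant of the vectors (`thetaEven`, `thetaOdd`) at x and y; all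
that is used of theta products later rests on this shape. -/
theorem theta_add_mul_theta_sub (p : ℝ) (hp0 : 0 < p) (hp1 : p < 1) (x y : ℂ) :
    theta p (x + y) * theta p (x - y)
      = 1 / 4 * (thetaEven p x * thetaOdd p y - thetaOdd p x * thetaEven p y) := by
  have hx := (summable_theta p hp0 hp1 (x + y)).norm
  have hy := (summable_theta p hp0 hp1 (x - y)).norm
  have hs := summable_mul_of_summable_norm hx hy
  have key := hx.of_norm.tsum_mul_tsum hy.of_norm hs
  simp only [theta_term_mul p hp0] at hs key
  have hs' := parityEquiv.summable_iff.mpr hs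
  have hl := hs'.comp_injective Sum.inl_injective
  have hr := hs'.comp_injective Sum.inr_injective
  have el : ∀ q : ℤ × ℤ, ((fun q : ℤ × ℤ => (-1 : ℂ) ^ (q.1 + q.2 + 1) *
      gaussTerm p (q.1 + q.2 + 1) x * gaussTerm p (q.1 - q.2) y) ∘ parityEquiv) (Sum.inl q)
      = gaussTerm p (2 * q.1) x * gaussTerm p (2 * q.2 + 1) y := by
    intro q
    have h1 : q.1 + q.2 + (q.1 - q.2 - 1) + 1 = 2 * q.1 := by ring
    have h2 : q.1 + q.2 - (q.1 - q.2 - 1) = 2 * q.2 + 1 := by ring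
    simp only [parityEquiv, Function.comp, Equiv.coe_fn_mk, Sum.elim_inl, h1, h2]
    rw [Even.neg_one_zpow (even_two_mul _), one_mul]
  have er : ∀ q : ℤ × ℤ, ((fun q : ℤ × ℤ => (-1 : ℂ) ^ (q.1 + q.2 + 1) *
      gaussTerm p (q.1 + q.2 + 1) x * gaussTerm p (q.1 - q.2) y) ∘ parityEquiv) (Sum.inr q)
      = -gaussTerm p (2 * q.1 + 1) x * gaussTerm p (2 * q.2) y := by
    intro q
    have h1 : q.1 + q.2 + (q.1 - q.2) + 1 = 2 * q.1 + 1 := by ring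
    have h2 : q.1 + q.2 - (q.1 - q.2) = 2 * q.2 := by ring
    simp only [parityEquiv, Function.comp, Equiv.coe_fn_mk, Sum.elim_inr, h1, h2]
    rw [Odd.neg_one_zpow (odd_two_mul_add_one _)]; ring
  have hl' : Summable fun q : ℤ × ℤ => gaussTerm p (2 * q.1) x * gaussTerm p (2 * q.2 + 1) y :=
    (summable_congr el).mp hl
  have hr' : Summable fun q : ℤ × ℤ => -gaussTerm p (2 * q.1 + 1) x * gaussTerm p (2 * q.2) y :=
    (summable_congr er).mp hr
  have sl : ∑' q : ℤ × ℤ, gaussTerm p (2 * q.1) x * gaussTerm p (2 * q.2 + 1) y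
      = thetaEven p x * thetaOdd p y := by
    rw [hl'.tsum_prod]
    simp only [tsum_mul_left, tsum_mul_right, thetaEven, thetaOdd]
  have sr : ∑' q : ℤ × ℤ, -gaussTerm p (2 * q.1 + 1) x * gaussTerm p (2 * q.2) y
      = -(thetaOdd p x * thetaEven p y) := by
    rw [hr'.tsum_prod]
    simp only [tsum_mul_left, tsum_mul_right, thetaEven, thetaOdd, tsum_neg, neg_mul]
  have key' := key.trans ((parityEquiv.tsum_eq _).symm.trans ((Summable.tsum_sum hl hr).trans
    (congrArg₂ (· + ·) ((tsum_congr el).trans sl) ((tsum_congr er).trans sr))))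
  unfold theta
  linear_combination (1 / 4) * key'

/-- The Weierstrass three-term identity. -/
theorem theta_three_term (p : ℝ) (hp0 : 0 < p) (hp1 : p < 1) (x y z w : ℂ) :
    theta p (x + y) * theta p (x - y) * (theta p (z + w) * theta p (z - w))
      + theta p (x + z) * theta p (x - z) * (theta p (w + y) * theta p (w - y))
      + theta p (x + w) * theta p (x - w) * (theta p (y + z) * theta p (y - z)) = 0 := by
  -- Each product of two thetas is now a 2×2 minor, and the claim is the Plücker relation for four
  -- vectors in a plane.
  simp only [theta_add_mul_theta_sub p hp0 hp1]; ring

/-! ### Analyticity of theta and density of generic heights. -/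

/-- Up to an exponential factor, theta is the Jacobi theta function in its first variable, with
modulus t = -i log p / π, so that exp(πi n² t) = p^(n²). -/
theorem differentiable_theta (p : ℝ) (hp0 : 0 < p) (hp1 : p < 1) :
    Differentiable ℂ (theta p) := by
  have hpi : (Real.pi : ℂ) ≠ 0 := by exact_mod_cast Real.pi_ne_zero
  set l : ℝ := Real.log p with hl
  have hlneg : l < 0 := Real.log_neg hp0 hp1
  set t : ℂ := ((-l / Real.pi : ℝ) : ℂ) * I with ht
  have him : 0 < t.im := by
    simp only [ht, mul_im, ofReal_re, I_im, ofReal_im, I_re]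
    have := div_pos (neg_pos.mpr hlneg) Real.pi_pos
    linarith
  have heq : theta p = fun x => 1 / 2 * (Complex.exp ((l : ℂ) / 4 - Real.pi * I / 2 - x) *
      jacobiTheta₂ (((l : ℂ) + Real.pi * I - 2 * x) / (2 * Real.pi * I)) t) := by
    funext x
    unfold theta jacobiTheta₂
    congr 1
    rw [← tsum_mul_left]
    refine tsum_congr fun n => ?_
    rw [jacobiTheta₂_term, cpow_def_of_ne_zero (by norm_num), log_neg_one,
      Real.rpow_def_of_pos hp0, ← hl, ofReal_exp, ← Complex.exp_add, ← Complex.exp_add,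
      ← Complex.exp_add]
    congr 1
    have h1 : 2 * (Real.pi : ℂ) * I * n * (((l : ℂ) + Real.pi * I - 2 * x) / (2 * Real.pi * I))
        = n * ((l : ℂ) + Real.pi * I - 2 * x) := by
      field_simp
    have h2 : (Real.pi : ℂ) * I * n ^ 2 * t = -((n : ℂ) ^ 2 * l) * (I * I) := by
      rw [ht]; push_cast; field_simp
    rw [h1, h2, I_mul_I]; push_cast; ring
  rw [heq]
  intro x
  have h : DifferentiableAt ℂ
      (fun u : ℂ => jacobiTheta₂ (((l : ℂ) + Real.pi * I - 2 * u) / (2 * Real.pi * I)) t) x :=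
    DifferentiableAt.comp (g := fun u => jacobiTheta₂ u t)
      (f := fun u : ℂ => ((l : ℂ) + Real.pi * I - 2 * u) / (2 * Real.pi * I)) x
      (differentiableAt_jacobiTheta₂_fst _ him) (by fun_prop)
  fun_prop

theorem continuous_theta (p : ℝ) (hp0 : 0 < p) (hp1 : p < 1) : Continuous (theta p) :=
  (differentiable_theta p hp0 hp1).continuous

/-- By the identity theorem, an entire function vanishing on an open set vanishes everywhere; one
known nonzero value `hz` excludes this. -/
theorem dense_theta_ne_zero (p : ℝ) (hp0 : 0 < p) (hp1 : p < 1) {z : ℂ} (hz : theta p z ≠ 0)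
    (c : ℂ) : Dense {x | theta p (x + c) ≠ 0} := by
  intro x
  by_contra hx
  have hev : ∀ᶠ u in nhds (x + c), theta p u = 0 := by
    have h : ∀ᶠ v in nhds x, theta p (v + c) = 0 := by
      rw [mem_closure_iff_frequently, Filter.not_frequently] at hx
      simpa using hx
    have : Filter.Tendsto (fun u => u - c) (nhds (x + c)) (nhds x) := by
      have : Continuous fun u : ℂ => u - c := by fun_prop
      simpa using this.tendsto (x + c)
    filter_upwards [this.eventually h] with u hu
    simpa using hu
  have han : AnalyticOnNhd ℂ (theta p) Set.univ :=
    fun u _ => (differentiable_theta p hp0 hp1).analyticAt u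
  exact hz (han.eqOn_zero_of_preconnected_of_eventuallyEq_zero isPreconnected_univ
    (Set.mem_univ (x + c)) hev (Set.mem_univ z))

/-- Baire: a countable intersection of dense open sets. -/
theorem dense_forall_theta_ne_zero (p : ℝ) (hp0 : 0 < p) (hp1 : p < 1) {z : ℂ}
    (hz : theta p z ≠ 0) (γ : ℂ) : Dense {τ | ∀ n : ℤ, theta p (τ + n * γ) ≠ 0} := by
  have := dense_iInter_of_isOpen (f := fun n : ℤ => {τ | theta p (τ + n * γ) ≠ 0})
    (fun n => isOpen_ne_fun ((continuous_theta p hp0 hp1).comp (by fun_prop)) continuous_const)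
    (fun n => dense_theta_ne_zero p hp0 hp1 hz _)
  simpa [Set.ofPred_forall] using this

end EllipticSOS

/-! ### The dynamical Yang-Baxter equation. -/

namespace EllipticSOS

/-- The three-term identity in the variables (A±B)/2, (C±D)/2. The eight derived arguments are left
free, tied by linear equations, so that each use can present them in the form, up to sign, in which
they occur in its goal. -/
theorem theta_relation (p : ℝ) (hp0 : 0 < p) (hp1 : p < 1)
    (A B C D x₁ x₂ x₃ x₄ y₁ y₂ y₃ y₄ : ℂ)
    (hx₁ : (A + B + C + D) / 2 = x₁) (hx₂ : (A + B - C - D) / 2 = x₂)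
    (hx₃ : (A - B + C - D) / 2 = x₃) (hx₄ : (B - A + C - D) / 2 = x₄)
    (hy₁ : (A + B + C - D) / 2 = y₁) (hy₂ : (A + B - C + D) / 2 = y₂)
    (hy₃ : (A - B + C + D) / 2 = y₃) (hy₄ : (A - B - C - D) / 2 = y₄) :
    theta p A * theta p B * theta p C * theta p D
      + theta p x₁ * theta p x₂ * theta p x₃ * theta p x₄
      + theta p y₁ * theta p y₂ * theta p y₃ * theta p y₄ = 0 := by
  subst hx₁ hx₂ hx₃ hx₄ hy₁ hy₂ hy₃ hy₄
  have h := theta_three_term p hp0 hp1 ((A + B) / 2) ((A - B) / 2) ((C + D) / 2) ((C - D) / 2)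
  rw [show (A + B) / 2 + (A - B) / 2 = A by ring, show (A + B) / 2 - (A - B) / 2 = B by ring,
    show (C + D) / 2 + (C - D) / 2 = C by ring, show (C + D) / 2 - (C - D) / 2 = D by ring,
    show (A + B) / 2 + (C + D) / 2 = (A + B + C + D) / 2 by ring,
    show (A + B) / 2 - (C + D) / 2 = (A + B - C - D) / 2 by ring,
    show (C - D) / 2 + (A - B) / 2 = (A - B + C - D) / 2 by ring,
    show (C - D) / 2 - (A - B) / 2 = (B - A + C - D) / 2 by ring,
    show (A + B) / 2 + (C - D) / 2 = (A + B + C - D) / 2 by ring,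
    show (A + B) / 2 - (C - D) / 2 = (A + B - C + D) / 2 by ring,
    show (A - B) / 2 + (C + D) / 2 = (A - B + C + D) / 2 by ring,
    show (A - B) / 2 - (C + D) / 2 = (A - B - C - D) / 2 by ring] at h
  linear_combination h

/-- This and the following lemmas are the nontrivial components of the Yang-Baxter equation, named
by their outer indices abc and a'b'c'. After clearing denominators each is a single three-term
relation, except for two components diagonal in these indices. -/
theorem yangBaxter_001_010 (p : ℝ) (hp0 : 0 < p) (hp1 : p < 1) (γ s x y : ℂ)
    (h0 : theta p s ≠ 0) (hm : theta p (s - γ) ≠ 0) :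
    theta p (x - y + γ) * (theta p (s - γ) * theta p x * (theta p s)⁻¹) * (theta p (s - γ - y) *
      theta p γ * (theta p (s - γ))⁻¹)
      = (theta p (s - γ) * theta p y * (theta p s)⁻¹) * (theta p (s - γ - x) * theta p γ *
      (theta p (s - γ))⁻¹) * (theta p (s + (x - y)) * theta p γ * (theta p s)⁻¹) +
      (theta p (s - y) * theta p γ * (theta p s)⁻¹) * theta p (x + γ) * (theta p (s - γ) *
      theta p (x - y) * (theta p s)⁻¹) := by
  have w0 := theta_relation p hp0 hp1 (x - y + γ) x (s - γ - y) s
    (s + (x - y)) (-(s - γ - x)) (-y) (-γ) (x - y) (x + γ) (s - y) (-(s - γ))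
    (by ring) (by ring) (by ring) (by ring) (by ring) (by ring) (by ring) (by ring)
  simp only [theta_neg] at w0
  grind

theorem yangBaxter_001_100 (p : ℝ) (hp0 : 0 < p) (hp1 : p < 1) (γ s x y : ℂ)
    (h0 : theta p s ≠ 0) (hm : theta p (s - γ) ≠ 0) :
    theta p (x - y + γ) * (theta p (s - x) * theta p γ * (theta p s)⁻¹) * theta p (y + γ)
      = (theta p (s - γ) * theta p y * (theta p s)⁻¹) * (theta p (s - γ - x) * theta p γ *
      (theta p (s - γ))⁻¹) * (theta p (s + γ) * theta p (x - y) * (theta p s)⁻¹) +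
      (theta p (s - y) * theta p γ * (theta p s)⁻¹) * theta p (x + γ) * (theta p (s - (x - y)) *
      theta p γ * (theta p s)⁻¹) := by
  have w0 := theta_relation p hp0 hp1 (x - y + γ) (s - x) (y + γ) s
    (s + γ) (-y) (-(s - γ - x)) (-(x - y)) γ (s - y) (x + γ) (-(s - (x - y)))
    (by ring) (by ring) (by ring) (by ring) (by ring) (by ring) (by ring) (by ring)
  simp only [theta_neg] at w0
  grind

theorem yangBaxter_010_001 (p : ℝ) (hp0 : 0 < p) (hp1 : p < 1) (γ s x y : ℂ)
    (h0 : theta p s ≠ 0) (hm : theta p (s - γ) ≠ 0) :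
    (theta p (s - γ - γ) * theta p (x - y) * (theta p (s - γ))⁻¹) * theta p (x + γ) *
      (theta p (s - γ + y) * theta p γ * (theta p (s - γ))⁻¹) + (theta p (s - γ - (x - y)) *
      theta p γ * (theta p (s - γ))⁻¹) * (theta p (s + x) * theta p γ * (theta p s)⁻¹) *
      (theta p (s - γ - γ) * theta p y * (theta p (s - γ))⁻¹)
      = (theta p (s + y) * theta p γ * (theta p s)⁻¹) * (theta p (s - γ - γ) * theta p x *
      (theta p (s - γ))⁻¹) * theta p (x - y + γ) := by
  have w0 := theta_relation p hp0 hp1 (x - y) (x + γ) (s - γ + y) s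
    (s + x) (-(s - γ - (x - y))) (-γ) y x (x - y + γ) (s - γ) (-(s + y))
    (by ring) (by ring) (by ring) (by ring) (by ring) (by ring) (by ring) (by ring)
  simp only [theta_neg] at w0
  grind

theorem yangBaxter_010_010 (p : ℝ) (hp0 : 0 < p) (hp1 : p < 1) (γ s x y : ℂ)
    (h0 : theta p s ≠ 0) (hm : theta p (s - γ) ≠ 0) :
    (theta p (s - γ - γ) * theta p (x - y) * (theta p (s - γ))⁻¹) * theta p (x + γ) * (theta p s *
      theta p y * (theta p (s - γ))⁻¹) + (theta p (s - γ - (x - y)) * theta p γ *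
      (theta p (s - γ))⁻¹) * (theta p (s + x) * theta p γ * (theta p s)⁻¹) *
      (theta p (s - γ - y) * theta p γ * (theta p (s - γ))⁻¹)
      = (theta p (s + y) * theta p γ * (theta p s)⁻¹) * (theta p (s - γ - x) * theta p γ *
      (theta p (s - γ))⁻¹) * (theta p (s + (x - y)) * theta p γ * (theta p s)⁻¹) +
      (theta p (s + γ) * theta p y * (theta p s)⁻¹) * theta p (x + γ) * (theta p (s - γ) *
      theta p (x - y) * (theta p s)⁻¹) := by
  -- Two relations are needed, both containing [2s - γ], which does not occur in the goal;
  -- eliminating it gives the claim. The first is independent of x and y and compares the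
  -- coefficients of [x - y][x + γ][y] on the two sides.
  have w0 := theta_relation p hp0 hp1 (s - γ - γ) s s (-s)
    (s - γ) (s - γ) (s - γ) (s + γ) (2 * s - γ) (-γ) (-γ) (-γ)
    (by ring) (by ring) (by ring) (by ring) (by ring) (by ring) (by ring) (by ring)
  simp only [theta_neg] at w0
  have w1 := theta_relation p hp0 hp1 (s - γ - (x - y)) (s + x) (s - γ - y) (-s)
    (s - γ) (s + y) (s - γ - x) (s + (x - y)) (2 * s - γ) y (-(x + γ)) (-(x - y))
    (by ring) (by ring) (by ring) (by ring) (by ring) (by ring) (by ring) (by ring)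
  simp only [theta_neg] at w1
  grind

theorem yangBaxter_010_100 (p : ℝ) (hp0 : 0 < p) (hp1 : p < 1) (γ s x y : ℂ)
    (h0 : theta p s ≠ 0) (hm : theta p (s - γ) ≠ 0) :
    (theta p (s - γ - (x - y)) * theta p γ * (theta p (s - γ))⁻¹) * (theta p (s + γ) * theta p x *
      (theta p s)⁻¹) * theta p (y + γ)
      = (theta p (s + y) * theta p γ * (theta p s)⁻¹) * (theta p (s - γ - x) * theta p γ *
      (theta p (s - γ))⁻¹) * (theta p (s + γ) * theta p (x - y) * (theta p s)⁻¹) +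
      (theta p (s + γ) * theta p y * (theta p s)⁻¹) * theta p (x + γ) * (theta p (s - (x - y)) *
      theta p γ * (theta p s)⁻¹) := by
  have w0 := theta_relation p hp0 hp1 (s - γ - (x - y)) x (y + γ) s
    (s + y) (-γ) (-(x - y)) (-(s - γ - x)) y (s - γ) (s - (x - y)) (-(x + γ))
    (by ring) (by ring) (by ring) (by ring) (by ring) (by ring) (by ring) (by ring)
  simp only [theta_neg] at w0
  grind

theorem yangBaxter_011_101 (p : ℝ) (hp0 : 0 < p) (hp1 : p < 1) (γ s x y : ℂ)
    (h0 : theta p s ≠ 0) (hq : theta p (s + γ) ≠ 0) :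
    (theta p s * theta p (x - y) * (theta p (s + γ))⁻¹) * (theta p (s - x) * theta p γ *
      (theta p s)⁻¹) * (theta p (s + γ + y) * theta p γ * (theta p (s + γ))⁻¹) +
      (theta p (s + γ - (x - y)) * theta p γ * (theta p (s + γ))⁻¹) * theta p (x + γ) *
      (theta p s * theta p y * (theta p (s + γ))⁻¹)
      = theta p (y + γ) * (theta p s * theta p x * (theta p (s + γ))⁻¹) * (theta p (s - (x - y)) *
      theta p γ * (theta p s)⁻¹) := by
  have w0 := theta_relation p hp0 hp1 (x - y) (s - x) γ (-(s + γ + y))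
    (-y) s (x + γ) (s + γ - (x - y)) (s + γ) (-(y + γ)) (-(s - (x - y))) x
    (by ring) (by ring) (by ring) (by ring) (by ring) (by ring) (by ring) (by ring)
  simp only [theta_neg] at w0
  grind

theorem yangBaxter_011_110 (p : ℝ) (hp0 : 0 < p) (hp1 : p < 1) (γ s x y : ℂ)
    (h0 : theta p s ≠ 0) (hq : theta p (s + γ) ≠ 0) :
    (theta p s * theta p (x - y) * (theta p (s + γ))⁻¹) * (theta p (s - x) * theta p γ *
      (theta p s)⁻¹) * (theta p (s + γ + γ) * theta p y * (theta p (s + γ))⁻¹) +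
      (theta p (s + γ - (x - y)) * theta p γ * (theta p (s + γ))⁻¹) * theta p (x + γ) *
      (theta p (s + γ - y) * theta p γ * (theta p (s + γ))⁻¹)
      = theta p (y + γ) * (theta p (s + γ - x) * theta p γ * (theta p (s + γ))⁻¹) *
      theta p (x - y + γ) := by
  have w0 := theta_relation p hp0 hp1 (x - y) (s - x) (s + γ + γ) (-y)
    (s + γ - y) (-γ) (x + γ) (s + γ - (x - y)) (s + γ) (-(y + γ)) (x - y + γ) (-(s + γ - x))
    (by ring) (by ring) (by ring) (by ring) (by ring) (by ring) (by ring) (by ring)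
  simp only [theta_neg] at w0
  grind

theorem yangBaxter_100_001 (p : ℝ) (hp0 : 0 < p) (hp1 : p < 1) (γ s x y : ℂ)
    (h0 : theta p s ≠ 0) (hm : theta p (s - γ) ≠ 0) :
    (theta p (s - γ + (x - y)) * theta p γ * (theta p (s - γ))⁻¹) * theta p (x + γ) *
      (theta p (s - γ + y) * theta p γ * (theta p (s - γ))⁻¹) + (theta p s * theta p (x - y) *
      (theta p (s - γ))⁻¹) * (theta p (s + x) * theta p γ * (theta p s)⁻¹) *
      (theta p (s - γ - γ) * theta p y * (theta p (s - γ))⁻¹)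
      = theta p (y + γ) * (theta p (s - γ + x) * theta p γ * (theta p (s - γ))⁻¹) *
      theta p (x - y + γ) := by
  have w0 := theta_relation p hp0 hp1 (s - γ + (x - y)) γ (x + γ) (s - γ + y)
    (s + x) (-y) (x - y) (-(s - γ - γ)) (x - y + γ) (s - γ) (s - γ + x) (-(y + γ))
    (by ring) (by ring) (by ring) (by ring) (by ring) (by ring) (by ring) (by ring)
  simp only [theta_neg] at w0
  grind

theorem yangBaxter_100_010 (p : ℝ) (hp0 : 0 < p) (hp1 : p < 1) (γ s x y : ℂ)
    (h0 : theta p s ≠ 0) (hm : theta p (s - γ) ≠ 0) :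
    (theta p (s - γ + (x - y)) * theta p γ * (theta p (s - γ))⁻¹) * theta p (x + γ) * (theta p s *
      theta p y * (theta p (s - γ))⁻¹) + (theta p s * theta p (x - y) * (theta p (s - γ))⁻¹) *
      (theta p (s + x) * theta p γ * (theta p s)⁻¹) * (theta p (s - γ - y) * theta p γ *
      (theta p (s - γ))⁻¹)
      = theta p (y + γ) * (theta p s * theta p x * (theta p (s - γ))⁻¹) * (theta p (s + (x - y)) *
      theta p γ * (theta p s)⁻¹) := by
  have w0 := theta_relation p hp0 hp1 (s - γ + (x - y)) (x + γ) s y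
    (s + x) (x - y) (s - γ - y) γ (s + (x - y)) x (s - γ) (-(y + γ))
    (by ring) (by ring) (by ring) (by ring) (by ring) (by ring) (by ring) (by ring)
  simp only [theta_neg] at w0
  grind

theorem yangBaxter_101_011 (p : ℝ) (hp0 : 0 < p) (hp1 : p < 1) (γ s x y : ℂ)
    (h0 : theta p s ≠ 0) (hq : theta p (s + γ) ≠ 0) :
    (theta p (s + γ + (x - y)) * theta p γ * (theta p (s + γ))⁻¹) * (theta p (s - γ) * theta p x *
      (theta p s)⁻¹) * theta p (y + γ)
      = (theta p (s - γ) * theta p y * (theta p s)⁻¹) * theta p (x + γ) * (theta p (s + (x - y)) *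
      theta p γ * (theta p s)⁻¹) + (theta p (s - y) * theta p γ * (theta p s)⁻¹) *
      (theta p (s + γ + x) * theta p γ * (theta p (s + γ))⁻¹) * (theta p (s - γ) *
      theta p (x - y) * (theta p s)⁻¹) := by
  have w0 := theta_relation p hp0 hp1 (s + γ + (x - y)) x (y + γ) (-s)
    (x + γ) (s + (x - y)) (s + γ) y (s + γ + x) (x - y) γ (s - y)
    (by ring) (by ring) (by ring) (by ring) (by ring) (by ring) (by ring) (by ring)
  simp only [theta_neg] at w0
  grind

theorem yangBaxter_101_101 (p : ℝ) (hp0 : 0 < p) (hp1 : p < 1) (γ s x y : ℂ)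
    (h0 : theta p s ≠ 0) (hq : theta p (s + γ) ≠ 0) :
    (theta p (s + γ + (x - y)) * theta p γ * (theta p (s + γ))⁻¹) * (theta p (s - x) * theta p γ *
      (theta p s)⁻¹) * (theta p (s + γ + y) * theta p γ * (theta p (s + γ))⁻¹) +
      (theta p (s + γ + γ) * theta p (x - y) * (theta p (s + γ))⁻¹) * theta p (x + γ) *
      (theta p s * theta p y * (theta p (s + γ))⁻¹)
      = (theta p (s - γ) * theta p y * (theta p s)⁻¹) * theta p (x + γ) * (theta p (s + γ) *
      theta p (x - y) * (theta p s)⁻¹) + (theta p (s - y) * theta p γ * (theta p s)⁻¹) *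
      (theta p (s + γ + x) * theta p γ * (theta p (s + γ))⁻¹) * (theta p (s - (x - y)) *
      theta p γ * (theta p s)⁻¹) := by
  -- As for the component 010, 010, with [2s + γ] as the quantity to eliminate.
  have w0 := theta_relation p hp0 hp1 (s + γ + (x - y)) (s - x) (s + γ + y) (-s)
    (s + γ) (s - y) (s + γ + x) (s - (x - y)) (2 * s + γ) (-y) (x + γ) (x - y)
    (by ring) (by ring) (by ring) (by ring) (by ring) (by ring) (by ring) (by ring)
  simp only [theta_neg] at w0
  have w1 := theta_relation p hp0 hp1 (s + γ + γ) s s (-s)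
    (s + γ) (s + γ) (s + γ) (s - γ) (2 * s + γ) γ γ γ
    (by ring) (by ring) (by ring) (by ring) (by ring) (by ring) (by ring) (by ring)
  simp only [theta_neg] at w1
  grind

theorem yangBaxter_101_110 (p : ℝ) (hp0 : 0 < p) (hp1 : p < 1) (γ s x y : ℂ)
    (h0 : theta p s ≠ 0) (hq : theta p (s + γ) ≠ 0) :
    (theta p (s + γ + (x - y)) * theta p γ * (theta p (s + γ))⁻¹) * (theta p (s - x) * theta p γ *
      (theta p s)⁻¹) * (theta p (s + γ + γ) * theta p y * (theta p (s + γ))⁻¹) +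
      (theta p (s + γ + γ) * theta p (x - y) * (theta p (s + γ))⁻¹) * theta p (x + γ) *
      (theta p (s + γ - y) * theta p γ * (theta p (s + γ))⁻¹)
      = (theta p (s - y) * theta p γ * (theta p s)⁻¹) * (theta p (s + γ + γ) * theta p x *
      (theta p (s + γ))⁻¹) * theta p (x - y + γ) := by
  have w0 := theta_relation p hp0 hp1 (s + γ + (x - y)) γ (s - x) (-y)
    (s + γ - y) (x + γ) s (-(x - y)) (s + γ) (x - y + γ) (s - y) x
    (by ring) (by ring) (by ring) (by ring) (by ring) (by ring) (by ring) (by ring)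
  simp only [theta_neg] at w0
  grind

theorem yangBaxter_110_011 (p : ℝ) (hp0 : 0 < p) (hp1 : p < 1) (γ s x y : ℂ)
    (h0 : theta p s ≠ 0) (hq : theta p (s + γ) ≠ 0) :
    theta p (x - y + γ) * (theta p (s + x) * theta p γ * (theta p s)⁻¹) * theta p (y + γ)
      = (theta p (s + y) * theta p γ * (theta p s)⁻¹) * theta p (x + γ) * (theta p (s + (x - y)) *
      theta p γ * (theta p s)⁻¹) + (theta p (s + γ) * theta p y * (theta p s)⁻¹) *
      (theta p (s + γ + x) * theta p γ * (theta p (s + γ))⁻¹) * (theta p (s - γ) *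
      theta p (x - y) * (theta p s)⁻¹) := by
  have w0 := theta_relation p hp0 hp1 (x - y + γ) (s + x) (y + γ) (-s)
    (x + γ) (s + (x - y)) γ (s + y) (s + γ + x) (x - y) (-(s - γ)) (-y)
    (by ring) (by ring) (by ring) (by ring) (by ring) (by ring) (by ring) (by ring)
  simp only [theta_neg] at w0
  grind

theorem yangBaxter_110_101 (p : ℝ) (hp0 : 0 < p) (hp1 : p < 1) (γ s x y : ℂ)
    (h0 : theta p s ≠ 0) (hq : theta p (s + γ) ≠ 0) :
    theta p (x - y + γ) * (theta p (s + γ) * theta p x * (theta p s)⁻¹) * (theta p (s + γ + y) *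
      theta p γ * (theta p (s + γ))⁻¹)
      = (theta p (s + y) * theta p γ * (theta p s)⁻¹) * theta p (x + γ) * (theta p (s + γ) *
      theta p (x - y) * (theta p s)⁻¹) + (theta p (s + γ) * theta p y * (theta p s)⁻¹) *
      (theta p (s + γ + x) * theta p γ * (theta p (s + γ))⁻¹) * (theta p (s - (x - y)) *
      theta p γ * (theta p s)⁻¹) := by
  have w0 := theta_relation p hp0 hp1 (x - y + γ) x (s + γ + y) (-s)
    (x + γ) (x - y) (s + γ) (s + y) (s + γ + x) (-(s - (x - y))) γ (-y)
    (by ring) (by ring) (by ring) (by ring) (by ring) (by ring) (by ring) (by ring)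
  simp only [theta_neg] at w0
  grind

section RMatrixEntries

variable (p : ℝ) (γ x τ : ℂ)

theorem rMatrix_00_00 : rMatrix p γ x τ (0, 0) (0, 0) = theta p (x + γ) := rfl
theorem rMatrix_11_11 : rMatrix p γ x τ (1, 1) (1, 1) = theta p (x + γ) := rfl
theorem rMatrix_01_01 : rMatrix p γ x τ (0, 1) (0, 1) =
    theta p (τ - γ) * theta p x * (theta p τ)⁻¹ := rfl
theorem rMatrix_01_10 : rMatrix p γ x τ (0, 1) (1, 0) =
    theta p (τ - x) * theta p γ * (theta p τ)⁻¹ := rfl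
theorem rMatrix_10_01 : rMatrix p γ x τ (1, 0) (0, 1) =
    theta p (τ + x) * theta p γ * (theta p τ)⁻¹ := rfl
theorem rMatrix_10_10 : rMatrix p γ x τ (1, 0) (1, 0) =
    theta p (τ + γ) * theta p x * (theta p τ)⁻¹ := rfl
theorem rMatrix_00_01 : rMatrix p γ x τ (0, 0) (0, 1) = 0 := rfl
theorem rMatrix_00_10 : rMatrix p γ x τ (0, 0) (1, 0) = 0 := rfl
theorem rMatrix_00_11 : rMatrix p γ x τ (0, 0) (1, 1) = 0 := rfl
theorem rMatrix_01_00 : rMatrix p γ x τ (0, 1) (0, 0) = 0 := rfl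
theorem rMatrix_01_11 : rMatrix p γ x τ (0, 1) (1, 1) = 0 := rfl
theorem rMatrix_10_00 : rMatrix p γ x τ (1, 0) (0, 0) = 0 := rfl
theorem rMatrix_10_11 : rMatrix p γ x τ (1, 0) (1, 1) = 0 := rfl
theorem rMatrix_11_00 : rMatrix p γ x τ (1, 1) (0, 0) = 0 := rfl
theorem rMatrix_11_01 : rMatrix p γ x τ (1, 1) (0, 1) = 0 := rfl
theorem rMatrix_11_10 : rMatrix p γ x τ (1, 1) (1, 0) = 0 := rfl

end RMatrixEntries

theorem cartanWeight_zero : cartanWeight 0 = 1 := rfl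
theorem cartanWeight_one : cartanWeight 1 = -1 := rfl

/-- Weight conservation of the dynamical `R`-matrix. -/
theorem rMatrix_eq_zero (p : ℝ) (γ x τ : ℂ) {a b c d : Fin 2}
    (h : cartanWeight a + cartanWeight b ≠ cartanWeight c + cartanWeight d) :
    rMatrix p γ x τ (a, b) (c, d) = 0 := by
  revert a b c d
  simp only [Fin.forall_fin_two, rMatrix_00_01, rMatrix_00_10, rMatrix_00_11, rMatrix_01_00,
    rMatrix_01_11, rMatrix_10_00, rMatrix_10_11, rMatrix_11_00, rMatrix_11_01, rMatrix_11_10,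
    cartanWeight_zero, cartanWeight_one]
  norm_num

/-- The dynamical Yang-Baxter equation. -/
theorem yangBaxter (p : ℝ) (hp0 : 0 < p) (hp1 : p < 1) (γ s x y : ℂ)
    (h0 : theta p s ≠ 0) (hm : theta p (s - γ) ≠ 0) (hq : theta p (s + γ) ≠ 0)
    (a b c a' b' c' : Fin 2) :
    ∑ e, ∑ f, ∑ g, rMatrix p γ (x - y) (s - γ * cartanWeight c) (a, b) (e, f) *
        rMatrix p γ x s (e, c) (a', g) *
        rMatrix p γ y (s - γ * cartanWeight a') (f, g) (b', c')
      = ∑ e, ∑ f, ∑ g, rMatrix p γ y s (b, c) (e, f) *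
        rMatrix p γ x (s - γ * cartanWeight e) (a, f) (g, c') *
        rMatrix p γ (x - y) s (g, e) (a', b') := by
  revert a b c a' b' c'
  simp only [Fin.forall_fin_two, Fin.sum_univ_two, cartanWeight_zero, cartanWeight_one,
    rMatrix_00_00, rMatrix_01_01, rMatrix_01_10, rMatrix_10_01, rMatrix_10_10, rMatrix_11_11,
    rMatrix_00_01, rMatrix_00_10, rMatrix_00_11, rMatrix_01_00, rMatrix_01_11, rMatrix_10_00,
    rMatrix_10_11, rMatrix_11_00, rMatrix_11_01, rMatrix_11_10, mul_zero, zero_mul, add_zero,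
    zero_add, mul_neg, mul_one, sub_neg_eq_add, sub_add_cancel, add_sub_cancel_right, and_true,
    true_and, and_self]
  -- Components violating weight conservation are gone; those closed by `ring` need only
  -- commutativity.
  exact ⟨⟨⟨by ring, ⟨by ring, yangBaxter_001_010 p hp0 hp1 γ s x y h0 hm⟩,
    yangBaxter_001_100 p hp0 hp1 γ s x y h0 hm⟩, ⟨⟨yangBaxter_010_001 p hp0 hp1 γ s x y h0 hm,
    yangBaxter_010_010 p hp0 hp1 γ s x y h0 hm⟩, yangBaxter_010_100 p hp0 hp1 γ s x y h0 hm⟩, by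
    ring, yangBaxter_011_101 p hp0 hp1 γ s x y h0 hq,
    yangBaxter_011_110 p hp0 hp1 γ s x y h0 hq⟩, ⟨⟨⟨yangBaxter_100_001 p hp0 hp1 γ s x y h0 hm,
    yangBaxter_100_010 p hp0 hp1 γ s x y h0 hm⟩, by ring⟩,
    yangBaxter_101_011 p hp0 hp1 γ s x y h0 hq, yangBaxter_101_101 p hp0 hp1 γ s x y h0 hq,
    yangBaxter_101_110 p hp0 hp1 γ s x y h0 hq⟩, ⟨yangBaxter_110_011 p hp0 hp1 γ s x y h0 hq,
    yangBaxter_110_101 p hp0 hp1 γ s x y h0 hq, by ring⟩, by ring⟩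

end EllipticSOS

/-! ### The monodromy matrix and the dynamical RTT relation. -/

namespace EllipticSOS

/-- The total weight of a basis vector of `W^{⊗L}`. -/
noncomputable def totalWeight {L : ℕ} (s : Fin L → Fin 2) : ℂ := ∑ k, cartanWeight (s k)

theorem totalWeight_succ {L : ℕ} (s : Fin (L + 1) → Fin 2) :
    totalWeight s = cartanWeight (s 0) + totalWeight (Fin.tail s) := by
  simp [totalWeight, Fin.sum_univ_succ, Fin.tail]

theorem sum_fin_cons {L : ℕ} {α M : Type*} [Fintype α] [AddCommMonoid M]
    (F : (Fin (L + 1) → α) → M) :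
    ∑ u, F u = ∑ g, ∑ u, F (Fin.cons g u) := by
  rw [← Fintype.sum_prod_type', ← (Fin.consEquiv fun _ => α).sum_comp]
  rfl

/-- The action of an operator on the auxiliary space and the last `L` factors, extended by the
identity on the first factor. -/
def liftTail {L : ℕ} : Matrix (Fin 2 × (Fin L → Fin 2)) (Fin 2 × (Fin L → Fin 2)) ℂ →*
    Matrix (Fin 2 × (Fin (L + 1) → Fin 2)) (Fin 2 × (Fin (L + 1) → Fin 2)) ℂ where
  toFun M := Matrix.of fun u v =>
    if u.2 0 = v.2 0 then M (u.1, Fin.tail u.2) (v.1, Fin.tail v.2) else 0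
  map_one' := by
    ext ⟨a, s⟩ ⟨b, t⟩
    have : s = t ↔ s 0 = t 0 ∧ Fin.tail s = Fin.tail t := by
      constructor
      · rintro rfl; exact ⟨rfl, rfl⟩
      · rintro ⟨h1, h2⟩; rw [← Fin.cons_self_tail s, ← Fin.cons_self_tail t, h1, h2]
    simp only [Matrix.of_apply, Matrix.one_apply, Prod.mk.injEq, this]
    split_ifs <;> simp_all
  map_mul' M N := by
    ext ⟨a, s⟩ ⟨b, t⟩
    simp only [Matrix.of_apply, Matrix.mul_apply, Fintype.sum_prod_type, sum_fin_cons,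
      Fin.cons_zero, Fin.tail_cons]
    split_ifs with h
    · refine Finset.sum_congr rfl fun e _ => ?_
      rw [Finset.sum_eq_single (s 0)]
      · simp [h]
      · intro g _ hg
        simp [hg.symm]
      · simp
    · symm
      refine Finset.sum_eq_zero fun e _ => Finset.sum_eq_zero fun g _ =>
        Finset.sum_eq_zero fun u _ => ?_
      by_cases h1 : s 0 = g
      · have : g ≠ t 0 := fun h2 => h (h1.trans h2)
        simp [this]
      · simp [h1]

theorem liftTail_apply {L : ℕ}
    (M : Matrix (Fin 2 × (Fin L → Fin 2)) (Fin 2 × (Fin L → Fin 2)) ℂ) (a b : Fin 2)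
    (s t : Fin (L + 1) → Fin 2) :
    liftTail M (a, s) (b, t) = if s 0 = t 0 then M (a, Fin.tail s) (b, Fin.tail t) else 0 := rfl

/-- The height of a site depends only on the sites to its right, so deleting the first site changes
nothing for the others. This permits induction on L by peeling sites off on the left. -/
theorem dynR_succ (p : ℝ) (γ : ℂ) {L : ℕ} (i : Fin L) (x τ : ℂ) :
    dynR p γ i.succ x τ = liftTail (dynR p γ i x τ) := by
  ext ⟨a, s⟩ ⟨b, t⟩
  have h : (∀ k, k ≠ i.succ → s k = t k) ↔
      s 0 = t 0 ∧ ∀ k, k ≠ i → Fin.tail s k = Fin.tail t k := by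
    rw [Fin.forall_fin_succ]
    simp [Fin.tail, (Fin.succ_ne_zero i).symm]
  simp only [liftTail_apply, dynR, Matrix.of_apply, h, Fin.Ioi_succ, Finset.sum_map]
  split_ifs <;> first | rfl | simp_all

theorem dynR_zero_apply (p : ℝ) (γ : ℂ) {L : ℕ} (x τ : ℂ) (a b : Fin 2)
    (s t : Fin (L + 1) → Fin 2) :
    dynR p γ 0 x τ (a, s) (b, t) = if Fin.tail s = Fin.tail t then
      rMatrix p γ x (τ - γ * totalWeight (Fin.tail s)) (a, s 0) (b, t 0) else 0 := by
  have h : (∀ k, k ≠ 0 → s k = t k) ↔ Fin.tail s = Fin.tail t := by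
    rw [Fin.forall_fin_succ, funext_iff]
    simp [Fin.tail]
  simp only [dynR, Matrix.of_apply, h]
  split_ifs with h1
  · rw [h1, totalWeight, Fin.Ioi_zero_eq_map, Finset.sum_map]; rfl
  · rfl

theorem monodromy_zero (p : ℝ) (γ : ℂ) (μ : Fin 0 → ℂ) (x τ : ℂ) :
    monodromy p γ μ x τ = 1 := by simp [monodromy]

theorem monodromy_succ_apply (p : ℝ) (γ : ℂ) {L : ℕ} (μ : Fin (L + 1) → ℂ) (x τ : ℂ)
    (a c : Fin 2) (s t : Fin (L + 1) → Fin 2) :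
    monodromy p γ μ x τ (a, s) (c, t) =
      ∑ e, rMatrix p γ (x - μ 0) (τ - γ * totalWeight (Fin.tail s)) (a, s 0) (e, t 0) *
        monodromy p γ (Fin.tail μ) x τ (e, Fin.tail s) (c, Fin.tail t) := by
  have h : monodromy p γ μ x τ =
      dynR p γ 0 (x - μ 0) τ * liftTail (monodromy p γ (Fin.tail μ) x τ) := by
    rw [monodromy, List.ofFn_succ, List.prod_cons, monodromy, map_list_prod, List.map_ofFn]
    congr 3
    funext i
    exact dynR_succ p γ i _ τ
  rw [h]
  simp only [Matrix.mul_apply, Fintype.sum_prod_type, sum_fin_cons, liftTail_apply,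
    dynR_zero_apply, Fin.cons_zero, Fin.tail_cons]
  refine Finset.sum_congr rfl fun e _ => ?_
  rw [Finset.sum_eq_single (t 0), Finset.sum_eq_single (Fin.tail s)]
  · simp
  · intro u _ hu; simp [hu.symm]
  · simp
  · intro g _ hg; simp [hg]
  · simp

/-- Weight conservation of the monodromy matrix. -/
theorem monodromy_weight (p : ℝ) (γ : ℂ) {L : ℕ} (μ : Fin L → ℂ) (x τ : ℂ)
    (a c : Fin 2) (s t : Fin L → Fin 2) (h : monodromy p γ μ x τ (a, s) (c, t) ≠ 0) :
    cartanWeight a + totalWeight s = cartanWeight c + totalWeight t := by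
  induction L generalizing a c with
  | zero =>
    rw [monodromy_zero, Matrix.one_apply] at h
    have := (ite_ne_right_iff.mp h).1
    rw [Prod.mk.injEq] at this
    rw [this.1, this.2]
  | succ L ih =>
    rw [monodromy_succ_apply] at h
    obtain ⟨e, -, he⟩ := Finset.exists_ne_zero_of_sum_ne_zero h
    have h1 := ih (Fin.tail μ) _ _ _ _ (right_ne_zero_of_mul he)
    have h2 := not_imp_comm.mp (rMatrix_eq_zero p γ (x - μ 0) _) (left_ne_zero_of_mul he)
    rw [totalWeight_succ, totalWeight_succ]
    linear_combination h1 + h2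

/-- The entries of the monodromy matrix with respect to the auxiliary space. -/
noncomputable def monodromyEntry (p : ℝ) (γ : ℂ) {L : ℕ} (μ : Fin L → ℂ) (a c : Fin 2) (x τ : ℂ) :
    Matrix (Fin L → Fin 2) (Fin L → Fin 2) ℂ :=
  Matrix.of fun s t => monodromy p γ μ x τ (a, s) (c, t)

/-- Peeling the first site off a product of two entries leaves a product of the same shape on the
remaining sites, with the same shift by the weight of c, as the induction for the RTT relation
requires. -/
theorem monodromyEntry_mul_succ_apply (p : ℝ) (γ : ℂ) {L : ℕ} (μ : Fin (L + 1) → ℂ)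
    (x y τ : ℂ) (a b c d : Fin 2) (s t : Fin (L + 1) → Fin 2) :
    (monodromyEntry p γ μ a c x τ *
        monodromyEntry p γ μ b d y (τ - γ * cartanWeight c)) s t =
      ∑ g, ∑ e, ∑ f,
        rMatrix p γ (x - μ 0) (τ - γ * totalWeight (Fin.tail s)) (a, s 0) (e, g) *
        rMatrix p γ (y - μ 0) (τ - γ * totalWeight (Fin.tail s) - γ * cartanWeight e)
          (b, g) (f, t 0) *
        (monodromyEntry p γ (Fin.tail μ) e c x τ *
          monodromyEntry p γ (Fin.tail μ) f d y (τ - γ * cartanWeight c))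
          (Fin.tail s) (Fin.tail t) := by
  rw [Matrix.mul_apply, sum_fin_cons]
  refine Finset.sum_congr rfl fun g _ => ?_
  simp only [Matrix.mul_apply, Finset.mul_sum]
  rw [Finset.sum_congr rfl fun e _ => Finset.sum_comm, Finset.sum_comm]
  refine Finset.sum_congr rfl fun u _ => ?_
  simp only [monodromyEntry, Matrix.of_apply, monodromy_succ_apply, Fin.cons_zero, Fin.tail_cons,
    Finset.sum_mul_sum]
  refine Finset.sum_congr rfl fun e _ => Finset.sum_congr rfl fun f _ => ?_
  -- The two heights differ in general, but weight conservation makes them equal whenever the entry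
  -- multiplying them is nonzero.
  by_cases h : monodromy p γ (Fin.tail μ) x τ (e, Fin.tail s) (c, u) = 0
  · rw [h]; ring
  · have hw := monodromy_weight p γ (Fin.tail μ) x τ _ _ _ _ h
    rw [show τ - γ * cartanWeight c - γ * totalWeight u
      = τ - γ * totalWeight (Fin.tail s) - γ * cartanWeight e by linear_combination γ * hw]
    ring

/-- Keeps all heights in τ + ℤγ, where nonvanishing is assumed. -/
theorem exists_int_totalWeight {L : ℕ} (s : Fin L → Fin 2) : ∃ n : ℤ, totalWeight s = n := by
  refine ⟨∑ k, ![1, -1] (s k), ?_⟩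
  rw [totalWeight]; push_cast
  refine Finset.sum_congr rfl fun k _ => ?_
  generalize s k = v
  fin_cases v <;> simp [cartanWeight]

/-- Passing an intertwiner `R` through one more site, given the local relation `hloc` for that
site and the relation `hrest` for the remaining ones. -/
theorem sum_exchange (R₁ R₂ R₃ X Y : Matrix (Fin 2 × Fin 2) (Fin 2 × Fin 2) ℂ)
    (X' Y' : Fin 2 → Matrix (Fin 2 × Fin 2) (Fin 2 × Fin 2) ℂ)
    (P : Fin 2 → Fin 2 → ℂ) (Q : Fin 2 → Fin 2 → Fin 2 → Fin 2 → ℂ) (a b i j c d : Fin 2)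
    (hloc : ∀ e' f', ∑ e, ∑ f, ∑ g, R₁ (a, b) (e, f) * X (e, i) (e', g) * Y' e' (f, g) (f', j) =
      ∑ k, ∑ l, ∑ m, Y (b, i) (k, l) * X' k (a, l) (m, j) * R₂ (m, k) (e', f'))
    (hrest : ∀ m k, ∑ e, ∑ f, R₂ (m, k) (e, f) * P e f =
      ∑ f, ∑ e, Q k f m e * R₃ (e, f) (c, d)) :
    ∑ e, ∑ f, R₁ (a, b) (e, f) *
        ∑ g, ∑ e', ∑ f', X (e, i) (e', g) * Y' e' (f, g) (f', j) * P e' f' =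
      ∑ f, ∑ e, (∑ g, ∑ k, ∑ m, Y (b, i) (k, g) * X' k (a, g) (m, j) * Q k f m e) *
        R₃ (e, f) (c, d) := by
  calc _ = ∑ e', ∑ f', (∑ e, ∑ f, ∑ g, R₁ (a, b) (e, f) * X (e, i) (e', g) *
          Y' e' (f, g) (f', j)) * P e' f' := by
        simp only [Fin.sum_univ_two]; ring
    _ = ∑ k, ∑ l, ∑ m, Y (b, i) (k, l) * X' k (a, l) (m, j) *
          ∑ e', ∑ f', R₂ (m, k) (e', f') * P e' f' := by
        simp only [hloc]; simp only [Fin.sum_univ_two]; ring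
    _ = _ := by
        simp only [hrest]; simp only [Fin.sum_univ_two]; ring

/-- The dynamical `RTT` relation. -/
theorem monodromy_exchange (p : ℝ) (hp0 : 0 < p) (hp1 : p < 1) (γ : ℂ) {L : ℕ} (μ : Fin L → ℂ)
    (x y τ : ℂ) (hτ : ∀ n : ℤ, theta p (τ + n * γ) ≠ 0) (a b c d : Fin 2) (s t : Fin L → Fin 2) :
    ∑ e, ∑ f, rMatrix p γ (x - y) (τ - γ * totalWeight s) (a, b) (e, f) *
        (monodromyEntry p γ μ e c x τ *
          monodromyEntry p γ μ f d y (τ - γ * cartanWeight c)) s t =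
      ∑ f, ∑ e, (monodromyEntry p γ μ b f y τ *
        monodromyEntry p γ μ a e x (τ - γ * cartanWeight f)) s t *
          rMatrix p γ (x - y) τ (e, f) (c, d) := by
  induction L generalizing a b with
  | zero =>
    have h1 : ∀ (a' c' : Fin 2) (z w : ℂ), monodromyEntry p γ μ a' c' z w
        = if a' = c' then 1 else 0 := by
      intro a' c' z w
      ext s t
      simp only [monodromyEntry, monodromy_zero, Matrix.of_apply, Matrix.one_apply,
        Prod.mk.injEq, Subsingleton.elim s t, and_true]
      split_ifs <;> simp
    have h2 : totalWeight s = 0 := by simp [totalWeight]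
    rw [h2, Subsingleton.elim s t]
    fin_cases a <;> fin_cases b <;> fin_cases c <;> fin_cases d <;> simp [h1]
  | succ L ih =>
    obtain ⟨n, hn⟩ := exists_int_totalWeight (Fin.tail s)
    have hσ : ∀ m : ℤ, theta p (τ - γ * totalWeight (Fin.tail s) + m * γ) ≠ 0 := by
      intro m
      have := hτ (m - n)
      rwa [hn, show τ - γ * n + m * γ = τ + (m - n : ℤ) * γ by push_cast; ring]
    -- The inhomogeneity cancels in the difference of spectral parameters, so the intertwiner has
    -- parameter x - y at every site. Crossing the site changes its height from σ - γ·(weight of `s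
    -- 0`) to σ, the height the induction hypothesis expects.
    have ybe := yangBaxter p hp0 hp1 γ (τ - γ * totalWeight (Fin.tail s)) (x - μ 0) (y - μ 0)
      (by simpa using hσ 0) (by simpa [sub_eq_add_neg] using hσ (-1)) (by simpa using hσ 1)
    rw [sub_sub_sub_cancel_right] at ybe
    have ih' := ih (Fin.tail μ) (s := Fin.tail s) (t := Fin.tail t)
    have hs : τ - γ * totalWeight s =
        τ - γ * totalWeight (Fin.tail s) - γ * cartanWeight (s 0) := by
      rw [totalWeight_succ]; ring
    simp only [monodromyEntry_mul_succ_apply, hs]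
    generalize τ - γ * totalWeight (Fin.tail s) = σ at *
    exact sum_exchange (rMatrix p γ (x - y) (σ - γ * cartanWeight (s 0))) (rMatrix p γ (x - y) σ)
      (rMatrix p γ (x - y) τ) (rMatrix p γ (x - μ 0) σ) (rMatrix p γ (y - μ 0) σ)
      (fun e => rMatrix p γ (x - μ 0) (σ - γ * cartanWeight e))
      (fun e => rMatrix p γ (y - μ 0) (σ - γ * cartanWeight e))
      (fun e f => (monodromyEntry p γ (Fin.tail μ) e c x τ *
        monodromyEntry p γ (Fin.tail μ) f d y (τ - γ * cartanWeight c)) (Fin.tail s) (Fin.tail t))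
      (fun b f a e => (monodromyEntry p γ (Fin.tail μ) b f y τ *
        monodromyEntry p γ (Fin.tail μ) a e x (τ - γ * cartanWeight f))
          (Fin.tail s) (Fin.tail t)) a b (s 0) (t 0) c d
      (fun e f => ybe a b (s 0) e f (t 0)) ih'

end EllipticSOS

/-! ### Exchange relations and the action of A on Bethe vectors. -/

namespace EllipticSOS

theorem continuous_rMatrix_apply (p : ℝ) (hp0 : 0 < p) (hp1 : p < 1) (γ τ : ℂ)
    (a b c d : Fin 2) : Continuous fun x => rMatrix p γ x τ (a, b) (c, d) := by
  have h := continuous_theta p hp0 hp1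
  revert a b c d
  simp only [Fin.forall_fin_two, rMatrix_00_00, rMatrix_01_01, rMatrix_01_10, rMatrix_10_01,
    rMatrix_10_10, rMatrix_11_11, rMatrix_00_01, rMatrix_00_10, rMatrix_00_11, rMatrix_01_00,
    rMatrix_01_11, rMatrix_10_00, rMatrix_10_11, rMatrix_11_00, rMatrix_11_01, rMatrix_11_10]
  refine ⟨⟨⟨⟨?_, ?_⟩, ?_, ?_⟩, ⟨?_, ?_⟩, ?_, ?_⟩, ⟨⟨?_, ?_⟩, ?_, ?_⟩, ⟨?_, ?_⟩, ?_, ?_⟩ <;> fun_prop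

theorem continuous_monodromy_apply (p : ℝ) (hp0 : 0 < p) (hp1 : p < 1) (γ : ℂ) {L : ℕ}
    (μ : Fin L → ℂ) (τ : ℂ) (a c : Fin 2) (s t : Fin L → Fin 2) :
    Continuous fun x => monodromy p γ μ x τ (a, s) (c, t) := by
  induction L generalizing a with
  | zero => simp only [monodromy_zero]; exact continuous_const
  | succ L ih =>
    simp only [monodromy_succ_apply]
    exact continuous_finsetSum _ fun e _ =>
      ((continuous_rMatrix_apply p hp0 hp1 γ _ _ _ _ _).comp
        (continuous_id.sub continuous_const)).mul (ih _ _ _ _)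

/-- Commutativity of the operators `B`, up to the dynamical shift. -/
theorem opB_comm (p : ℝ) (hp0 : 0 < p) (hp1 : p < 1) (γ : ℂ) {L : ℕ} (μ : Fin L → ℂ)
    (x y τ : ℂ) (hτ : ∀ n : ℤ, theta p (τ + n * γ) ≠ 0) :
    opB p γ μ x τ * opB p γ μ y (τ + γ) = opB p γ μ y τ * opB p γ μ x (τ + γ) := by
  ext s t
  have hcont : ∀ σ u v, Continuous fun z => opB p γ μ z σ u v := fun σ u v =>
    continuous_monodromy_apply p hp0 hp1 γ μ σ 0 1 u v
  -- The RTT component (0,0), (1,1) gives the equality multiplied by [z - y + γ]; the factor cancels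
  -- on a dense set of z, and continuity in z does the rest.
  have hd := dense_theta_ne_zero p hp0 hp1 (hτ 0) (γ - y)
  have heq := Continuous.ext_on hd
    (f := fun z => (opB p γ μ z τ * opB p γ μ y (τ + γ)) s t)
    (g := fun z => (opB p γ μ y τ * opB p γ μ z (τ + γ)) s t)
    (by simp only [Matrix.mul_apply]
        exact continuous_finsetSum _ fun u _ => (hcont _ _ _).mul continuous_const)
    (by simp only [Matrix.mul_apply]
        exact continuous_finsetSum _ fun u _ => continuous_const.mul (hcont _ _ _))
    (fun z hz => by
      have h := monodromy_exchange p hp0 hp1 γ μ z y τ hτ 0 0 1 1 s t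
      simp only [Fin.sum_univ_two, cartanWeight_one, cartanWeight_zero, rMatrix_00_00,
        rMatrix_00_01, rMatrix_00_10, rMatrix_00_11, rMatrix_01_11, rMatrix_10_11, rMatrix_11_11,
        zero_mul, mul_zero, add_zero, zero_add, mul_neg, mul_one, sub_neg_eq_add] at h
      rw [mul_comm] at h
      refine mul_right_cancel₀ ?_ h
      rwa [show z - y + γ = z + (γ - y) by ring])
  exact congrFun heq x

/-- The exchange relation between `A` and `B`. -/
theorem entryA_mul_opB (p : ℝ) (hp0 : 0 < p) (hp1 : p < 1) (γ : ℂ) {L : ℕ} (μ : Fin L → ℂ)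
    (x x₀ τ : ℂ) (hτ : ∀ n : ℤ, theta p (τ + n * γ) ≠ 0) (hx : theta p (x - x₀) ≠ 0) :
    monodromyEntry p γ μ 0 0 x₀ τ * opB p γ μ x (τ - γ) =
      (theta p τ * theta p (x - x₀ + γ) / (theta p (τ + γ) * theta p (x - x₀))) •
        (opB p γ μ x τ * monodromyEntry p γ μ 0 0 x₀ (τ + γ)) -
      (theta p (τ - x + x₀) * theta p γ / (theta p (τ + γ) * theta p (x - x₀))) •
        (opB p γ μ x₀ τ * monodromyEntry p γ μ 0 0 x (τ + γ)) := by
  ext s t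
  have h0 : theta p τ ≠ 0 := by simpa using hτ 0
  have h1 : theta p (τ + γ) ≠ 0 := by simpa using hτ 1
  -- In this component A(x₀)B(x) appears with the coefficient [τ + γ][x - x₀]/[τ], which is then
  -- inverted.
  have h := monodromy_exchange p hp0 hp1 γ μ x x₀ τ hτ 0 0 1 0 s t
  simp only [Fin.sum_univ_two, cartanWeight_one, cartanWeight_zero, rMatrix_00_00,
    rMatrix_00_01, rMatrix_00_10, rMatrix_00_11, rMatrix_01_10, rMatrix_10_10, rMatrix_11_10,
    zero_mul, mul_zero, add_zero, zero_add, mul_neg, mul_one, sub_neg_eq_add] at h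
  simp only [Matrix.sub_apply, Matrix.smul_apply, smul_eq_mul]
  rw [show τ - (x - x₀) = τ - x + x₀ by ring] at h
  have hB : ∀ x τ, monodromyEntry p γ μ 0 1 x τ = opB p γ μ x τ := fun _ _ => rfl
  simp only [hB] at h
  field_simp at h ⊢
  linear_combination -h

/-- The ordered product `B(x₁, σ) B(x₂, σ + γ) ⋯`. -/
noncomputable def prodB (p : ℝ) (γ : ℂ) {L : ℕ} (μ : Fin L → ℂ) :
    ℂ → List ℂ → Matrix (Fin L → Fin 2) (Fin L → Fin 2) ℂ
  | _, [] => 1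
  | σ, x :: X => opB p γ μ x σ * prodB p γ μ (σ + γ) X

theorem prodB_ofFn (p : ℝ) (γ : ℂ) {L N : ℕ} (μ : Fin L → ℂ) (σ : ℂ) (x : Fin N → ℂ) :
    prodB p γ μ σ (List.ofFn x) =
      (List.ofFn fun j : Fin N => opB p γ μ (x j) (σ + ((j : ℕ) : ℂ) * γ)).prod := by
  induction N generalizing σ with
  | zero => simp [prodB]
  | succ N ih =>
    rw [List.ofFn_succ, List.ofFn_succ, List.prod_cons, prodB, ih]
    congr 3
    · simp
    · funext j
      congr 1
      push_cast [Fin.val_succ]; ring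

theorem generic_add {p : ℝ} {γ τ : ℂ} (hτ : ∀ n : ℤ, theta p (τ + n * γ) ≠ 0) (m : ℤ) :
    ∀ n : ℤ, theta p (τ + m * γ + n * γ) ≠ 0 := by
  intro n
  have := hτ (m + n)
  rwa [show τ + m * γ + n * γ = τ + (m + n : ℤ) * γ by push_cast; ring]

theorem generic_add_gamma {p : ℝ} {γ τ : ℂ} (hτ : ∀ n : ℤ, theta p (τ + n * γ) ≠ 0) :
    ∀ n : ℤ, theta p (τ + γ + n * γ) ≠ 0 := by
  simpa using generic_add hτ 1

/-- Adjacent transpositions suffice: heights belong to positions, not to spectral parameters, and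
`opB_comm` swaps two neighbouring parameters. -/
theorem prodB_perm (p : ℝ) (hp0 : 0 < p) (hp1 : p < 1) (γ : ℂ) {L : ℕ} (μ : Fin L → ℂ)
    {X Y : List ℂ} (h : X.Perm Y) (σ : ℂ) (hσ : ∀ n : ℤ, theta p (σ + n * γ) ≠ 0) :
    prodB p γ μ σ X = prodB p γ μ σ Y := by
  induction h generalizing σ with
  | nil => rfl
  | cons x _ ih => rw [prodB, prodB, ih _ (generic_add_gamma hσ)]
  | swap x y X =>
    simp only [prodB, ← mul_assoc]
    rw [opB_comm p hp0 hp1 γ μ x y σ hσ]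
  | trans _ _ ih₁ ih₂ => exact (ih₁ σ hσ).trans (ih₂ σ hσ)

theorem cons_ofFn_update_perm {N : ℕ} (X : Fin N → ℂ) (i : Fin N) (a b : ℂ) :
    (a :: List.ofFn (Function.update X i b)).Perm (b :: List.ofFn (Function.update X i a)) := by
  have h := Equiv.Perm.ofFn_comp_perm (Equiv.swap 0 i.succ)
    (Fin.cons a (Function.update X i b) : Fin (N + 1) → ℂ)
  have he : (Fin.cons a (Function.update X i b) : Fin (N + 1) → ℂ) ∘ Equiv.swap 0 i.succ =
      Fin.cons b (Function.update X i a) := by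
    funext k
    refine Fin.cases ?_ (fun k => ?_) k
    · simp
    · by_cases hk : k = i
      · subst hk
        rw [Function.comp_apply, Equiv.swap_apply_right, Fin.cons_zero, Fin.cons_succ,
          Function.update_self]
      · have : Equiv.swap 0 i.succ k.succ = k.succ :=
          Equiv.swap_apply_of_ne_of_ne (Fin.succ_ne_zero _) (by simpa using hk)
        simp [this, hk]
  rw [he, List.ofFn_cons, List.ofFn_cons] at h
  exact h.symm

/-- The term in which a later parameter y is replaced by x₀ arises in two ways when A passes the
first B(x); this adds up the two coefficients. -/
theorem theta_exchange_coeff (p : ℝ) (hp0 : 0 < p) (hp1 : p < 1) (γ σ x₀ x y : ℂ)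
    (h1 : theta p (σ + γ) ≠ 0) (hx : theta p (x - x₀) ≠ 0) (hy : theta p (y - x₀) ≠ 0)
    (hxy : theta p (y - x) ≠ 0) :
    theta p σ * theta p (x - x₀ + γ) / (theta p (σ + γ) * theta p (x - x₀)) *
        (theta p (σ + γ - y + x₀) / theta p (y - x₀)) -
      theta p (σ - x + x₀) * theta p γ / (theta p (σ + γ) * theta p (x - x₀)) *
        (theta p (σ + γ - y + x) / theta p (y - x)) =
      theta p (σ - y + x₀) / theta p (y - x₀) * (theta p (x - y + γ) / theta p (x - y)) := by
  have w := theta_relation p hp0 hp1 σ (x - x₀ + γ) (σ + γ - y + x₀) (y - x)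
    (σ + γ) (x - x₀) (σ - y + x₀) (x - y + γ) (σ + γ - y + x) (y - x₀) (σ - x + x₀) (-γ)
    (by ring) (by ring) (by ring) (by ring) (by ring) (by ring) (by ring) (by ring)
  rw [theta_neg] at w
  have hn : theta p (x - y) = -theta p (y - x) := by rw [← theta_neg, neg_sub]
  rw [hn]
  field_simp
  linear_combination w

open Matrix in
/-- The action of `A(x₀)` on the Bethe vector `B(X₁) ⋯ B(X_N) v`, where `v` is an eigenvector of
all the operators `A`. -/
theorem entryA_mulVec_prodB (p : ℝ) (hp0 : 0 < p) (hp1 : p < 1) (γ : ℂ) {L : ℕ} (μ : Fin L → ℂ)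
    (v : (Fin L → Fin 2) → ℂ) (α : ℂ → ℂ)
    (hv : ∀ x τ, monodromyEntry p γ μ 0 0 x τ *ᵥ v = α x • v) {N : ℕ} (X : Fin N → ℂ) (x₀ σ : ℂ)
    (hσ : ∀ n : ℤ, theta p (σ + n * γ) ≠ 0) (hX₀ : ∀ j, theta p (X j - x₀) ≠ 0)
    (hX : ∀ i j, i ≠ j → theta p (X j - X i) ≠ 0) :
    monodromyEntry p γ μ 0 0 x₀ σ *ᵥ (prodB p γ μ (σ - γ) (List.ofFn X) *ᵥ v) =
      (theta p σ / theta p (σ + N * γ) * (∏ j, theta p (X j - x₀ + γ) / theta p (X j - x₀)) *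
        α x₀) • (prodB p γ μ σ (List.ofFn X) *ᵥ v) -
      ∑ i, (theta p (σ - X i + x₀) * theta p γ / (theta p (X i - x₀) * theta p (σ + N * γ)) *
        (∏ j, if j = i then 1 else theta p (X j - X i + γ) / theta p (X j - X i)) * α (X i)) •
          (prodB p γ μ σ (List.ofFn (Function.update X i x₀)) *ᵥ v) := by
  induction N generalizing x₀ σ with
  | zero =>
    have h0 : theta p σ ≠ 0 := by simpa using hσ 0
    simp [prodB, hv, h0]
  | succ N ih =>
    have h1 : theta p (σ + γ) ≠ 0 := by simpa using hσ 1
    have hσ' := generic_add_gamma hσ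
    -- After passing the first B, the operator A carries either x₀ or, if the parameters were
    -- exchanged, X 0; hence two instances of the induction hypothesis.
    have ih₀ := ih (Fin.tail X) x₀ (σ + γ) hσ' (fun j => hX₀ _)
      (fun i j h => hX _ _ (by simpa using h))
    have ih₁ := ih (Fin.tail X) (X 0) (σ + γ) hσ' (fun j => hX _ _ (Fin.succ_ne_zero _).symm)
      (fun i j h => hX _ _ (by simpa using h))
    have hN : σ + γ + (N : ℂ) * γ = σ + ((N + 1 : ℕ) : ℂ) * γ := by push_cast; ring
    rw [add_sub_cancel_right, hN] at ih₀ ih₁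
    have hofFn : List.ofFn X = X 0 :: List.ofFn (Fin.tail X) := List.ofFn_succ
    have hup0 : List.ofFn (Function.update X 0 x₀) = x₀ :: List.ofFn (Fin.tail X) := by
      rw [List.ofFn_succ]
      congr 1
    have hup : ∀ i : Fin N, List.ofFn (Function.update X i.succ x₀) =
        X 0 :: List.ofFn (Function.update (Fin.tail X) i x₀) := by
      intro i
      rw [List.ofFn_succ, Function.update_of_ne (Fin.succ_ne_zero i).symm]
      congr 2
      exact Fin.tail_update_succ X i x₀
    -- Symmetry of the B's identifies the unwanted vectors of `ih₁` with those of `ih₀`.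
    have hperm : ∀ i : Fin N, opB p γ μ x₀ σ *ᵥ (prodB p γ μ (σ + γ)
          (List.ofFn (Function.update (Fin.tail X) i (X 0))) *ᵥ v) =
        opB p γ μ (X 0) σ *ᵥ (prodB p γ μ (σ + γ)
          (List.ofFn (Function.update (Fin.tail X) i x₀)) *ᵥ v) := by
      intro i
      simp only [mulVec_mulVec]
      exact congrArg (· *ᵥ v) (prodB_perm p hp0 hp1 γ μ
        (cons_ofFn_update_perm (Fin.tail X) i x₀ (X 0)) σ hσ)
    rw [Fin.sum_univ_succ, hup0, hofFn]
    simp only [hup, prodB, sub_add_cancel, ← mulVec_mulVec]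
    rw [mulVec_mulVec, entryA_mul_opB p hp0 hp1 γ μ (X 0) x₀ σ hσ (hX₀ 0), sub_mulVec,
      smul_mulVec, smul_mulVec, ← mulVec_mulVec, ← mulVec_mulVec, ih₀, ih₁]
    simp only [mulVec_sub, mulVec_smul, mulVec_sum, hperm, smul_sub, Finset.smul_sum, smul_smul]
    have hsum : ∀ (a b c d : (Fin L → Fin 2) → ℂ) (f g h : Fin N → (Fin L → Fin 2) → ℂ),
        a = c → b = d → (∀ i, f i - g i = h i) →
        a - ∑ i, f i - (b - ∑ i, g i) = c - (d + ∑ i, h i) := by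
      rintro a b c d f g h rfl rfl hfg
      simp only [← hfg, Finset.sum_sub_distrib]
      abel
    -- Coefficients are matched for the unchanged list, the list with X 0 replaced, and the lists
    -- with a later entry replaced; only the last needs a theta identity.
    refine hsum _ _ _ _ _ _ _ ?_ ?_ fun i => ?_
    · congr 1
      rw [Fin.prod_univ_succ]
      simp only [Fin.tail]
      field_simp
    · congr 1
      rw [Fin.prod_univ_succ]
      simp only [Fin.tail, Fin.succ_ne_zero, if_false, if_true]
      field_simp
    · rw [← sub_smul]
      congr 1
      have hc := theta_exchange_coeff p hp0 hp1 γ σ x₀ (X 0) (X i.succ) h1 (hX₀ 0) (hX₀ _)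
        (hX _ _ (Fin.succ_ne_zero i).symm)
      rw [Fin.prod_univ_succ]
      simp only [Fin.tail, (Fin.succ_ne_zero i).symm, if_false, Fin.succ_inj]
      generalize (∏ j : Fin N, if j = i then (1 : ℂ) else
        theta p (X j.succ - X i.succ + γ) / theta p (X j.succ - X i.succ)) = π
      have hS := hσ (N + 1 : ℕ)
      rw [Int.cast_natCast] at hS
      calc _ = (theta p σ * theta p (X 0 - x₀ + γ) / (theta p (σ + γ) * theta p (X 0 - x₀)) *
            (theta p (σ + γ - X i.succ + x₀) / theta p (X i.succ - x₀)) -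
          theta p (σ - X 0 + x₀) * theta p γ / (theta p (σ + γ) * theta p (X 0 - x₀)) *
            (theta p (σ + γ - X i.succ + X 0) / theta p (X i.succ - X 0))) *
            (theta p γ / theta p (σ + ((N + 1 : ℕ) : ℂ) * γ) * π * α (X i.succ)) := by
            ring
        _ = _ := by rw [hc]; ring

end EllipticSOS

/-! ### Reference vectors and the functional equation at generic height. -/

namespace EllipticSOS

open Matrix

theorem ketZero_apply {L : ℕ} (s : Fin L → Fin 2) :
    ketZero L s = if s = fun _ => 0 then 1 else 0 := by
  unfold ketZero
  split_ifs with h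
  · simp [h]
  · obtain ⟨i, hi⟩ := Function.ne_iff.mp h
    exact Finset.prod_eq_zero (Finset.mem_univ i) (by simp [Fin.eq_one_of_ne_zero _ hi])

theorem braZeroBar_apply {L : ℕ} (s : Fin L → Fin 2) :
    braZeroBar L s = if s = fun _ => 1 then 1 else 0 := by
  unfold braZeroBar
  split_ifs with h
  · simp [h]
  · obtain ⟨i, hi⟩ := Function.ne_iff.mp h
    have : s i = 0 := by
      generalize s i = v at hi
      revert hi; revert v; decide
    exact Finset.prod_eq_zero (Finset.mem_univ i) (by simp [this])

theorem eq_const_succ_iff {L : ℕ} (s : Fin (L + 1) → Fin 2) (v : Fin 2) :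
    (s = fun _ => v) ↔ s 0 = v ∧ Fin.tail s = fun _ => v := by
  constructor
  · rintro rfl; exact ⟨rfl, rfl⟩
  · rintro ⟨h0, h1⟩
    funext k
    exact Fin.cases h0 (fun i => congrFun h1 i) k

/-- Every R fixes the line of v₁⊗v₁ with eigenvalue [x + γ], whatever the height, so the product
acts on the all-up state by a scalar. -/
theorem monodromy_apply_ket (p : ℝ) (γ : ℂ) {L : ℕ} (μ : Fin L → ℂ) (x τ : ℂ) (a : Fin 2)
    (s : Fin L → Fin 2) :
    monodromy p γ μ x τ (a, s) (0, fun _ => 0) =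
      if a = 0 ∧ s = fun _ => 0 then ∏ j, theta p (x - μ j + γ) else 0 := by
  induction L generalizing a with
  | zero => simp [monodromy_zero, Matrix.one_apply, Subsingleton.elim s fun _ => 0]
  | succ L ih =>
    rw [monodromy_succ_apply]
    simp only [eq_const_succ_iff]
    have : Fin.tail (fun _ : Fin (L + 1) => (0 : Fin 2)) = fun _ => 0 := rfl
    simp only [this, ih, Fin.sum_univ_two, Fin.prod_univ_succ, Fin.tail]
    generalize s 0 = v
    fin_cases a <;> fin_cases v <;>
      simp [rMatrix_00_00, rMatrix_01_00, rMatrix_10_00, rMatrix_11_00]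

theorem entryA_mulVec_ketZero (p : ℝ) (γ : ℂ) {L : ℕ} (μ : Fin L → ℂ) (x τ : ℂ) :
    monodromyEntry p γ μ 0 0 x τ *ᵥ ketZero L =
      (∏ j, theta p (x - μ j + γ)) • ketZero L := by
  ext s
  simp [mulVec, dotProduct, ketZero_apply, monodromyEntry, monodromy_apply_ket]

theorem totalWeight_const_one (L : ℕ) : totalWeight (fun _ : Fin L => (1 : Fin 2)) = -L := by
  simp [totalWeight, cartanWeight_one]

theorem monodromy_one_bra_apply_zero (p : ℝ) (γ : ℂ) {L : ℕ} (μ : Fin L → ℂ) (x τ : ℂ)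
    (t : Fin L → Fin 2) : monodromy p γ μ x τ (1, fun _ => 1) (0, t) = 0 := by
  induction L with
  | zero => simp [monodromy_zero]
  | succ L ih =>
    rw [monodromy_succ_apply]
    have h : Fin.tail (fun _ : Fin (L + 1) => (1 : Fin 2)) = fun _ => 1 := rfl
    generalize t 0 = v
    fin_cases v <;> simp [Fin.sum_univ_two, h, ih, rMatrix_11_00, rMatrix_11_01]

/-- With n down-spins to its right a site has height τ + nγ and contributes [τ + (n-1)γ][x - μ]/[τ +
nγ]; the height factors telescope. The other auxiliary channel drops out by
`monodromy_one_bra_apply_zero`. -/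
theorem monodromy_bra_apply (p : ℝ) (γ : ℂ) {L : ℕ} (μ : Fin L → ℂ) (x τ : ℂ)
    (hτ : ∀ n : ℤ, theta p (τ + n * γ) ≠ 0) (t : Fin L → Fin 2) :
    monodromy p γ μ x τ (0, fun _ => 1) (0, t) =
      if t = fun _ => 1 then
        theta p (τ - γ) / theta p (τ + L * γ - γ) * ∏ j, theta p (x - μ j) else 0 := by
  induction L with
  | zero =>
    have h : theta p (τ - γ) ≠ 0 := by simpa [sub_eq_add_neg] using hτ (-1)
    simp [monodromy_zero, Subsingleton.elim t fun _ => 1, h]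
  | succ L ih =>
    rw [monodromy_succ_apply]
    simp only [eq_const_succ_iff]
    have h : Fin.tail (fun _ : Fin (L + 1) => (1 : Fin 2)) = fun _ => 1 := rfl
    have h1 : theta p (τ + L * γ - γ) ≠ 0 := by
      have := hτ (L - 1)
      rwa [show τ + ((L - 1 : ℤ) : ℂ) * γ = τ + L * γ - γ by push_cast; ring] at this
    have h2 : τ + ((L + 1 : ℕ) : ℂ) * γ - γ = τ + L * γ := by push_cast; ring
    have h3 : τ - γ * -(L : ℂ) = τ + L * γ := by ring
    simp only [h, ih, Fin.sum_univ_two, monodromy_one_bra_apply_zero, totalWeight_const_one,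
      Fin.prod_univ_succ, Fin.tail, h2, h3]
    generalize t 0 = v
    fin_cases v
    · simp [rMatrix_01_00]
    · simp only [Fin.mk_one, rMatrix_01_01, mul_zero, add_zero, true_and]
      split_ifs
      · field_simp
      · simp

theorem braZeroBar_vecMul_entryA (p : ℝ) (γ : ℂ) {L : ℕ} (μ : Fin L → ℂ) (x τ : ℂ)
    (hτ : ∀ n : ℤ, theta p (τ + n * γ) ≠ 0) :
    braZeroBar L ᵥ* monodromyEntry p γ μ 0 0 x τ =
      (theta p (τ - γ) / theta p (τ + L * γ - γ) * ∏ j, theta p (x - μ j)) • braZeroBar L := by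
  ext t
  simp [vecMul, dotProduct, braZeroBar_apply, monodromyEntry, monodromy_bra_apply _ _ _ _ _ hτ]

theorem partitionFunction_eq (p : ℝ) (γ : ℂ) {L : ℕ} (μ : Fin L → ℂ) (τ : ℂ) (x : Fin L → ℂ) :
    partitionFunction p γ μ τ x =
      braZeroBar L ⬝ᵥ (prodB p γ μ (τ + γ) (List.ofFn x) *ᵥ ketZero L) := by
  rw [partitionFunction, prodB_ofFn]
  congr 5
  funext j
  congr 1
  ring

/-- The functional equation, away from the zeros of all the `[τ + nγ]`. -/
theorem functional_equation_of_generic (p : ℝ) (hp0 : 0 < p) (hp1 : p < 1) {L : ℕ}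
    (γ τ : ℂ) (μ : Fin L → ℂ) (x₀ : ℂ) (x : Fin L → ℂ)
    (hτ : ∀ n : ℤ, theta p (τ + n * γ) ≠ 0) (hx₀ : ∀ j, theta p (x j - x₀) ≠ 0)
    (hx : ∀ i j, i ≠ j → theta p (x j - x i) ≠ 0) :
    coeffM p γ μ τ x₀ * partitionFunction p γ μ τ x
      + (coeffNZero p γ μ τ x₀ x * partitionFunction p γ μ (τ + γ) x
        + ∑ i, coeffN p γ μ τ x₀ x i *
            partitionFunction p γ μ (τ + γ) (Function.update x i x₀)) = 0 := by
  have hσ : ∀ n : ℤ, theta p (τ + 2 * γ + n * γ) ≠ 0 := by simpa using generic_add hτ 2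
  -- The height τ + 2γ for A is chosen so that the B's start at τ + γ before the exchange, as in
  -- Z_τ, and at τ + 2γ after it, as in Z_{τ+γ}.
  have h := congrArg (braZeroBar L ⬝ᵥ ·) (entryA_mulVec_prodB p hp0 hp1 γ μ (ketZero L)
    (fun x => ∏ j, theta p (x - μ j + γ)) (entryA_mulVec_ketZero p γ μ) x x₀ (τ + 2 * γ)
    hσ hx₀ hx)
  have h1 : τ + 2 * γ - γ = τ + γ := by ring
  have h2 : τ + γ + γ = τ + 2 * γ := by ring
  have h3 : τ + 2 * γ + L * γ - γ = τ + ((L : ℂ) + 1) * γ := by ring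
  have h4 : τ + 2 * γ + L * γ = τ + ((L : ℂ) + 2) * γ := by ring
  simp only [dotProduct_mulVec _ (monodromyEntry p γ μ 0 0 x₀ (τ + 2 * γ)),
    braZeroBar_vecMul_entryA _ _ _ _ _ hσ, smul_dotProduct, dotProduct_sub, dotProduct_sum,
    dotProduct_smul, smul_eq_mul, h3] at h
  rw [h1, h4, ← partitionFunction_eq] at h
  simp only [← h2, ← partitionFunction_eq p γ μ (τ + γ)] at h
  simp only [h2] at h
  have hN : ∀ i, coeffN p γ μ τ x₀ x i = theta p (τ + 2 * γ - x i + x₀) * theta p γ /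
      (theta p (x i - x₀) * theta p (τ + ((L : ℂ) + 2) * γ)) *
      (∏ j, if j = i then 1 else theta p (x j - x i + γ) / theta p (x j - x i)) *
        ∏ j, theta p (x i - μ j + γ) := by
    intro i
    have he : ∏ j, (if j = i then 1 else theta p (x j - x i + γ) / theta p (x j - x i)) =
        ∏ j ∈ Finset.univ.erase i, theta p (x j - x i + γ) / theta p (x j - x i) := by
      rw [← Finset.prod_erase Finset.univ (a := i) (by simp)]
      exact Finset.prod_congr rfl fun j hj => if_neg (Finset.ne_of_mem_erase hj)
    rw [coeffN, he, show τ + 2 * γ + x₀ - x i = τ + 2 * γ - x i + x₀ by ring]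
    ring
  simp only [hN, coeffM, coeffNZero]
  linear_combination h

/-! ### Continuity in the height and removal of genericity. -/

theorem continuousAt_rMatrix_apply (p : ℝ) (hp0 : 0 < p) (hp1 : p < 1) (γ x τ : ℂ)
    (hτ : theta p τ ≠ 0) (a b c d : Fin 2) :
    ContinuousAt (fun σ => rMatrix p γ x σ (a, b) (c, d)) τ := by
  have h := continuous_theta p hp0 hp1
  have hinv : ContinuousAt (fun σ => (theta p σ)⁻¹) τ := h.continuousAt.inv₀ hτ
  revert a b c d
  simp only [Fin.forall_fin_two, rMatrix_00_00, rMatrix_01_01, rMatrix_01_10, rMatrix_10_01,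
    rMatrix_10_10, rMatrix_11_11, rMatrix_00_01, rMatrix_00_10, rMatrix_00_11, rMatrix_01_00,
    rMatrix_01_11, rMatrix_10_00, rMatrix_10_11, rMatrix_11_00, rMatrix_11_01, rMatrix_11_10]
  refine ⟨⟨⟨⟨?_, ?_⟩, ?_, ?_⟩, ⟨?_, ?_⟩, ?_, ?_⟩, ⟨⟨?_, ?_⟩, ?_, ?_⟩, ⟨?_, ?_⟩, ?_, ?_⟩ <;> fun_prop

/-- Only the row index s matters in the hypothesis: when the factor at site i acts, the sites to its
right have not yet been changed from s. -/
theorem continuousAt_monodromy_apply (p : ℝ) (hp0 : 0 < p) (hp1 : p < 1) (γ : ℂ) {L : ℕ}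
    (μ : Fin L → ℂ) (x τ : ℂ) (a c : Fin 2) (s t : Fin L → Fin 2)
    (hs : ∀ i, theta p (τ - γ * ∑ k ∈ Finset.Ioi i, cartanWeight (s k)) ≠ 0) :
    ContinuousAt (fun σ => monodromy p γ μ x σ (a, s) (c, t)) τ := by
  induction L generalizing a with
  | zero => simp only [monodromy_zero]; exact continuousAt_const
  | succ L ih =>
    simp only [monodromy_succ_apply]
    have h0 : theta p (τ - γ * totalWeight (Fin.tail s)) ≠ 0 := by
      have := hs 0
      rwa [Fin.Ioi_zero_eq_map, Finset.sum_map] at this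
    have hi : ∀ i, theta p (τ - γ * ∑ k ∈ Finset.Ioi i, cartanWeight (Fin.tail s k)) ≠ 0 := by
      intro i
      have := hs i.succ
      rwa [Fin.Ioi_succ, Finset.sum_map] at this
    refine tendsto_finsetSum _ fun e _ => Filter.Tendsto.mul ?_ (ih _ _ _ _ hi)
    exact ContinuousAt.comp (f := fun σ => σ - γ * totalWeight (Fin.tail s))
      (continuousAt_rMatrix_apply p hp0 hp1 γ _ _ h0 _ _ _ _) (by fun_prop)

theorem sum_cartanWeight {L : ℕ} (s : Fin L → Fin 2) (S : Finset (Fin L)) :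
    ∑ k ∈ S, cartanWeight (s k) =
      ((S.filter (s · = 0)).card : ℂ) - ((S.filter (¬ s · = 0)).card : ℂ) := by
  rw [← Finset.sum_filter_add_sum_filter_not S (s · = 0),
    Finset.sum_congr rfl (g := fun _ => (1 : ℂ)) (s₁ := S.filter (s · = 0)),
    Finset.sum_congr rfl (g := fun _ => (-1 : ℂ)) (s₁ := S.filter (¬ s · = 0))]
  · simp [sub_eq_add_neg]
  · intro k hk
    rw [Fin.eq_one_of_ne_zero _ (Finset.mem_filter.mp hk).2, cartanWeight_one]
  · intro k hk
    rw [(Finset.mem_filter.mp hk).2, cartanWeight_zero]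

theorem totalWeight_eq {L : ℕ} (s : Fin L → Fin 2) :
    totalWeight s = 2 * ((Finset.univ.filter (s · = 0)).card : ℂ) - L := by
  have h := Finset.card_filter_add_card_filter_not (s := (Finset.univ : Finset (Fin L))) (s · = 0)
  rw [Finset.card_univ, Fintype.card_fin] at h
  have h' : (L : ℂ) = ((Finset.univ.filter (s · = 0)).card : ℂ) +
      ((Finset.univ.filter (¬ s · = 0)).card : ℂ) := by exact_mod_cast h.symm
  rw [totalWeight, sum_cartanWeight]
  linear_combination h'

/-- The heights at which `B` is evaluated on a basis covector with `j` up-spins. -/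
theorem exists_height {L : ℕ} (s : Fin L → Fin 2) (j : ℕ)
    (hs : (Finset.univ.filter (s · = 0)).card = j) (i : Fin L) :
    ∃ n : ℕ, 1 ≤ n ∧ n ≤ L + 1 ∧
      (j : ℂ) + 1 - ∑ k ∈ Finset.Ioi i, cartanWeight (s k) = n := by
  have hu := Finset.card_le_card
    (Finset.filter_subset_filter (s · = 0) (Finset.subset_univ (Finset.Ioi i)))
  have hd := Finset.card_le_card
    (Finset.filter_subset_filter (¬ s · = 0) (Finset.subset_univ (Finset.Ioi i)))
  have h := Finset.card_filter_add_card_filter_not (s := (Finset.univ : Finset (Fin L))) (s · = 0)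
  rw [Finset.card_univ, Fintype.card_fin] at h
  -- One plus the up-spins not to the right of i plus the down-spins to its right. The truncated
  -- subtraction is exact by `hu`, and the total is at most j + 1 + (L - j).
  refine ⟨j - ((Finset.Ioi i).filter (s · = 0)).card + 1 +
    ((Finset.Ioi i).filter (¬ s · = 0)).card, by omega, by omega, ?_⟩
  rw [sum_cartanWeight]
  push_cast [Nat.cast_sub (hs ▸ hu)]
  ring

/-- The invariant couples the spin count to the height: a row vector supported on states with j
up-spins meets B at height σ + (j+1)γ, which by `exists_height` sees only the heights assumed
nonzero. Letting r vary with σ allows the induction to absorb the leftmost B into it. -/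
theorem continuousAt_dotProduct_prodB (p : ℝ) (hp0 : 0 < p) (hp1 : p < 1) (γ : ℂ) {L : ℕ}
    (μ : Fin L → ℂ) (τ : ℂ) (hτ : ∀ n : ℕ, 1 ≤ n → n ≤ L + 1 → theta p (τ + n * γ) ≠ 0)
    (w : (Fin L → Fin 2) → ℂ) (X : List ℂ) (j : ℕ) (r : ℂ → (Fin L → Fin 2) → ℂ)
    (hr : ∀ s, ContinuousAt (fun σ => r σ s) τ)
    (hsupp : ∀ σ s, r σ s ≠ 0 → (Finset.univ.filter (s · = 0)).card = j) :
    ContinuousAt (fun σ => r σ ⬝ᵥ (prodB p γ μ (σ + ((j : ℂ) + 1) * γ) X *ᵥ w)) τ := by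
  induction X generalizing j r with
  | nil =>
    simp only [prodB, one_mulVec, dotProduct]
    exact tendsto_finsetSum _ fun s _ => (hr s).mul continuousAt_const
  | cons x X ih =>
    have h := ih (j + 1) (fun σ => r σ ᵥ* opB p γ μ x (σ + ((j : ℂ) + 1) * γ)) ?_ ?_
    · refine h.congr (Filter.Eventually.of_forall fun σ => ?_)
      have he : σ + ((j : ℂ) + 1) * γ + γ = σ + (((j + 1 : ℕ) : ℂ) + 1) * γ := by push_cast; ring
      beta_reduce
      rw [← dotProduct_mulVec, mulVec_mulVec, prodB, he]
    · intro t
      simp only [vecMul, dotProduct]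
      refine tendsto_finsetSum _ fun s _ => ?_
      by_cases hs : (Finset.univ.filter (s · = 0)).card = j
      · refine (hr s).mul ?_
        refine ContinuousAt.comp (f := fun σ => σ + ((j : ℂ) + 1) * γ)
          (g := fun σ => opB p γ μ x σ s t)
          (continuousAt_monodromy_apply p hp0 hp1 γ μ x _ 0 1 s t fun i => ?_) (by fun_prop)
        obtain ⟨n, h1, h2, hn⟩ := exists_height s j hs i
        rw [show τ + ((j : ℂ) + 1) * γ - γ * ∑ k ∈ Finset.Ioi i, cartanWeight (s k) = τ + n * γ by
          rw [← hn]; ring]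
        exact hτ n h1 h2
      · have : ∀ σ, r σ s = 0 := fun σ => not_imp_comm.mp (hsupp σ s) hs
        simp only [this, zero_mul]
        exact tendsto_const_nhds
    · intro σ t ht
      -- Weight conservation: passing from row to column, B raises the total weight by 2, that is,
      -- adds one up-spin.
      obtain ⟨s, -, hs⟩ := Finset.exists_ne_zero_of_sum_ne_zero ht
      have h1 := hsupp σ s (left_ne_zero_of_mul hs)
      have h2 := monodromy_weight p γ μ x _ 0 1 s t (right_ne_zero_of_mul hs)
      rw [totalWeight_eq, totalWeight_eq, h1, cartanWeight_zero, cartanWeight_one] at h2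
      have h3 : ((Finset.univ.filter (t · = 0)).card : ℂ) = ((j + 1 : ℕ) : ℂ) := by
        push_cast; linear_combination (-1 / 2) * h2
      exact_mod_cast h3

theorem continuousAt_partitionFunction (p : ℝ) (hp0 : 0 < p) (hp1 : p < 1) (γ : ℂ) {L : ℕ}
    (μ : Fin L → ℂ) (τ : ℂ) (hτ : ∀ n : ℕ, 1 ≤ n → n ≤ L + 1 → theta p (τ + n * γ) ≠ 0)
    (x : Fin L → ℂ) : ContinuousAt (fun σ => partitionFunction p γ μ σ x) τ := by
  have h := continuousAt_dotProduct_prodB p hp0 hp1 γ μ τ hτ (ketZero L) (List.ofFn x) 0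
    (fun _ => braZeroBar L) (fun _ => continuousAt_const) ?_
  · simpa [partitionFunction_eq] using h
  · intro _ s hs
    rw [braZeroBar_apply] at hs
    rw [(ite_ne_right_iff.mp hs).1]
    simp

end EllipticSOS

open EllipticSOS in
theorem theorem1 (p : ℝ) (hp0 : 0 < p) (hp1 : p < 1) (L : ℕ) (hL : 0 < L)
    (γ τ : ℂ) (μ : Fin L → ℂ) (x₀ : ℂ) (x : Fin L → ℂ)
    (hτ : ∀ n : ℕ, 1 ≤ n → n ≤ L + 2 → EllipticSOS.theta p (τ + (n : ℂ) * γ) ≠ 0)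
    (hx₀ : ∀ j, EllipticSOS.theta p (x j - x₀) ≠ 0)
    (hx : ∀ i j, i ≠ j → EllipticSOS.theta p (x j - x i) ≠ 0) :
    EllipticSOS.coeffM p γ μ τ x₀ * EllipticSOS.partitionFunction p γ μ τ x
      + (EllipticSOS.coeffNZero p γ μ τ x₀ x * EllipticSOS.partitionFunction p γ μ (τ + γ) x
        + ∑ i, EllipticSOS.coeffN p γ μ τ x₀ x i *
            EllipticSOS.partitionFunction p γ μ (τ + γ) (Function.update x i x₀)) = 0 := by
  have hθ := continuous_theta p hp0 hp1
  have h1 : theta p (τ + ((L : ℂ) + 1) * γ) ≠ 0 := by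
    simpa using hτ (L + 1) (by omega) (by omega)
  have h2 : theta p (τ + ((L : ℂ) + 2) * γ) ≠ 0 := by
    simpa using hτ (L + 2) (by omega) le_rfl
  have hZ : ContinuousAt (fun σ => partitionFunction p γ μ σ x) τ :=
    continuousAt_partitionFunction p hp0 hp1 γ μ τ (fun n hn hn' => hτ n hn (by omega)) x
  have hZ' : ∀ y : Fin L → ℂ, ContinuousAt (fun σ => partitionFunction p γ μ (σ + γ) y) τ := by
    intro y
    refine ContinuousAt.comp (f := fun σ => σ + γ) (g := fun σ => partitionFunction p γ μ σ y)
      (continuousAt_partitionFunction p hp0 hp1 γ μ _ (fun n hn hn' => ?_) y) (by fun_prop)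
    -- Z_τ needs the heights n = 1, …, L+1 and Z_{τ+γ} needs n = 2, …, L+2; together they make up
    -- the assumed range.
    have := hτ (n + 1) (by omega) (by omega)
    rwa [show τ + γ + n * γ = τ + ((n + 1 : ℕ) : ℂ) * γ by push_cast; ring]
  have hcM : ContinuousAt (fun σ => coeffM p γ μ σ x₀) τ := by
    unfold coeffM
    refine ContinuousAt.mul (ContinuousAt.div ?_ ?_ h1) continuousAt_const <;> fun_prop
  have hc0 : ContinuousAt (fun σ => coeffNZero p γ μ σ x₀ x) τ := by
    unfold coeffNZero
    refine ContinuousAt.mul (ContinuousAt.mul (ContinuousAt.neg (ContinuousAt.div ?_ ?_ h2))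
      continuousAt_const) continuousAt_const <;> fun_prop
  have hcN : ∀ i, ContinuousAt (fun σ => coeffN p γ μ σ x₀ x i) τ := by
    intro i
    unfold coeffN
    refine ContinuousAt.mul (ContinuousAt.mul (ContinuousAt.div ?_ ?_ (mul_ne_zero (hx₀ i) h2))
      continuousAt_const) continuousAt_const <;> fun_prop
  have hF : ContinuousAt (fun σ => coeffM p γ μ σ x₀ * partitionFunction p γ μ σ x
      + (coeffNZero p γ μ σ x₀ x * partitionFunction p γ μ (σ + γ) x
        + ∑ i, coeffN p γ μ σ x₀ x i *
            partitionFunction p γ μ (σ + γ) (Function.update x i x₀))) τ :=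
    (hcM.mul hZ).add ((hc0.mul (hZ' x)).add
      (tendsto_finsetSum _ fun i _ => (hcN i).mul (hZ' _)))
  -- A nonzero value at τ would persist nearby, yet arbitrarily close to τ there are generic σ,
  -- where the equation holds. Here `h1` also witnesses that theta is not identically zero.
  by_contra hne
  obtain ⟨σ, hσ, hσ'⟩ := mem_closure_iff_frequently.mp
    (dense_forall_theta_ne_zero p hp0 hp1 h1 γ τ) |>.and_eventually (hF.eventually_ne hne) |>.exists
  exact hσ' (functional_equation_of_generic p hp0 hp1 γ σ μ x₀ x hσ hx₀ hx)
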